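/- Let $G$ be a finite abelian group, $\mathbb F$ an algebraically closed field with $\operatorname{char}(\mathbb F)\nmid |G|$, and $\rho\colon G\to \mathrm{GL}(V)$ a representation on a finite-dimensional $\mathbb F$-vector space $V$. Let $x_1,\dots,x_n$ be a basis of $V^*$ consisting of $G$-eigenvectors, $g\cdot x_i=\chi_i(g)x_i$ for all $g\in G$, with $\chi_i\in \mathrm{Hom}(G,\mathbb F^\bullet)$, where $\mathbb F^\bullet=\mathbb F\setminus\{0\}$ and $(g\cdot \ell)(v)=\ell(\rho(g)^{-1}v)$ for $\ell\in V^*$. Each $\chi_i$ is trivial on $\ker\rho$ and is also regarded as a character of $\rho(G)$. The group $\mathrm{GL}(V)$ acts on $\mathbb F[V]=\mathbb F[x_1,\dots,x_n]$ by $\mathbb F$-algebra automorphisms extending its action on $V^*$. Let $D$ be the monoid of non-zero relative invariants of $\rho(G)$ (polynomials $f\neq 0$ with $\gamma\cdot f=\chi(\gamma) f$ for all $\gamma\in\rho(G)$, for some character $\chi=w(f)\in\mathrm{Hom}(\rho(G),\mathbb F^\bullet)$, the weight of $f$), taken modulo non-zero constants. Let $H\subset D$ be the submonoid of classes of non-zero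 $\rho(G)$-invariants, $M\subset D$ the submonoid of (classes of) monomials in $x_1,\dots,x_n$, $M^G=M\cap H$, $D_0=\{\gcd_D(X)\colon X\subset H \text{ finite, non-empty}\}$ and $M_0=M\cap D_0$. Let $$e(x_i)=\min\{\mathsf v_{x_i}(h)\colon h\in H,\ x_i\mid_D h\},$$ where $\mathsf v_{x_i}(h)$ is the exponent of the highest power of $x_i$ dividing $h$ in $D$. A pseudoreflection is a non-identity, non-unipotent element of $\mathrm{GL}(V)$ that fixes a hyperplane of $V$ pointwise; $\mathrm{Hom}^0(\rho(G),\mathbb F^\bullet)$ is the group of all characters of $\rho(G)$ that are trivial on every pseudoreflection in $\rho(G)$. For a monoid $S$, $\mathcal A(S)$ is its set of atoms, $\mathsf q(S)$ its quotient group, and $\langle\,\cdot\,\rangle$ denotes the generated subgroup. Then $D_0$ is a submonoid of $D$, and the following hold. 1. $M_0\subset D_0$ is divisor closed (if $a\in M_0$, $b\in D_0$ and $b$ divides $a$ in $D_0$, then $b\in M_0$), $M_0$ is free abelian, and $\mathcal A(M_0)=M\cap\mathcal A(D_0)=\{x_1^{e(x_1)},\dots,x_n^{e(x_n)}\}$.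 2. For every $i$, $e(x_i)=\min\{k\in\mathbb N,\ k\ge 1\colon \chi_i^k\in\langle\chi_j\colon j\neq i\rangle\}$. 3. $\mathrm{Hom}^0(\rho(G),\mathbb F^\bullet)$ is generated by $\{\chi_1^{e(x_1)},\dots,\chi_n^{e(x_n)}\}$, and $\mathbb F[x_1^{e(x_1)},\dots,x_n^{e(x_n)}]=\mathbb F[V]^{G_1}$, where $G_1$ is the subgroup of $\rho(G)$ generated by the pseudoreflections in $\rho(G)$. 4. $M^G\subset M_0$, and the embedding $M^G\hookrightarrow M_0$ is a divisor theory: divisibility in $M_0$ between elements of $M^G$ implies divisibility in $M^G$, $M_0$ is free abelian, and each of its basis elements is the greatest common divisor in $M_0$ of a finite non-empty subset of $M^G$. The weight induces a group isomorphism $\overline w\colon \mathcal C(M^G)=\mathsf q(M_0)/\mathsf q(M^G)\to \mathrm{Hom}^0(\rho(G),\mathbb F^\bullet)$ with $\overline w([m])=w(m)$ for all $m\in M_0$, and the image under $\overline w$ of the set of classes containing prime elements of $M_0$ is exactly $\{\chi_1^{e(x_1)},\dots,\chi_n^{e(x_n)}\}$. -/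

import Mathlib

namespace InvTheory

noncomputable section

/-! ### Monoids -/

/-- `d` is a greatest common divisor of the elements of `X`. -/
def IsGcdOf {D : Type*} [CommMonoid D] (X : Set D) (d : D) : Prop :=
  (∀ a ∈ X, d ∣ a) ∧ ∀ c : D, (∀ a ∈ X, c ∣ a) → c ∣ d

/-- A prime element of a (multiplicatively written, zero-free) monoid. -/
def IsPrimeElement {D : Type*} [CommMonoid D] (p : D) : Prop :=
  ¬ IsUnit p ∧ ∀ a b : D, p ∣ a * b → p ∣ a ∨ p ∣ b

/-- `D` is the free abelian monoid with basis `P ⊆ D`: every element of `D` can be written in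
exactly one way as `∏_{p ∈ P} p ^ a_p` with almost all exponents equal to `0`. -/
def IsFreeBasis {D : Type*} [CommMonoid D] (P : Set D) : Prop :=
  Function.Bijective fun a : P →₀ ℕ => a.prod fun p k => (p : D) ^ k

/-- `D` is a free abelian monoid. -/
def IsFreeAbelian (D : Type*) [CommMonoid D] : Prop :=
  ∃ P : Set D, IsFreeBasis P

/-- The set of atoms of a submonoid `S` of `D`, as a subset of `D` (irreducibility is meant in
the monoid `S`). -/
def atomsOf {D : Type*} [CommMonoid D] (S : Submonoid D) : Set D :=
  (fun a : S => (a : D)) '' {a : S | Irreducible a}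

/-- The submonoid `S` is contained in the submonoid `T`, and it is divisor closed in `T`
(divisibility is meant in the monoid `T`). -/
def IsDivisorClosed {D : Type*} [CommMonoid D] (S T : Submonoid D) : Prop :=
  S ≤ T ∧ ∀ a ∈ S, ∀ b ∈ T, (∃ c ∈ T, a = b * c) → b ∈ S

/-- A divisor homomorphism. -/
def IsDivisorHom {H D : Type*} [CommMonoid H] [CommMonoid D] (φ : H →* D) : Prop :=
  ∀ a b : H, φ a ∣ φ b → a ∣ b

/-- A divisor theory: a divisor homomorphism into a free abelian monoid such that every basis
element is the greatest common divisor of the image of a finite non-empty set. -/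
def IsDivisorTheory {H D : Type*} [CommMonoid H] [CommMonoid D] (φ : H →* D) : Prop :=
  IsDivisorHom φ ∧ ∃ P : Set D, IsFreeBasis P ∧
    ∀ p ∈ P, ∃ X : Finset H, X.Nonempty ∧ IsGcdOf (φ '' (X : Set H)) p

/-- The class group `q(D) / q(φ(H))` of a monoid homomorphism `φ : H → D`. -/
abbrev ClassGroupOf {H D : Type*} [CommMonoid H] [CommMonoid D] (φ : H →* D) : Type _ :=
  Algebra.GrothendieckGroup D ⧸
    Subgroup.closure (Set.range fun h : H => Algebra.GrothendieckGroup.of (φ h))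

/-- The class `[d]` of `d ∈ D` in the class group of `φ : H → D`. -/
def classOf {H D : Type*} [CommMonoid H] [CommMonoid D] (φ : H →* D) (d : D) :
    ClassGroupOf φ :=
  QuotientGroup.mk (Algebra.GrothendieckGroup.of d)

/-- The set of classes of `φ : H → D` that contain a prime element of `D`. -/
def primeClasses {H D : Type*} [CommMonoid H] [CommMonoid D] (φ : H →* D) :
    Set (ClassGroupOf φ) :=
  classOf φ '' {p : D | IsPrimeElement p}

/-! ### Group actions on polynomial rings

`V` is a vector space, `x = (x₁, …, xₙ)` is a basis of its dual space, and the symmetric algebra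
`F[V]` of the dual space is the polynomial ring `F[x₁, …, xₙ] = MvPolynomial (Fin n) F`. -/

section Action

variable {F : Type*} [Field F] {V : Type*} [AddCommGroup V] [Module F V] {n : ℕ}

/-- The action of `GL(V)` on the dual space: `(γ ℓ)(v) = ℓ(γ⁻¹ v)`. -/
def dualAct (γ : LinearMap.GeneralLinearGroup F V) (l : Module.Dual F V) : Module.Dual F V :=
  l ∘ₗ ((γ⁻¹ : LinearMap.GeneralLinearGroup F V) : V →ₗ[F] V)

/-- A linear form, written in the basis `x`, as a homogeneous polynomial of degree `1`. -/
def linearForm (x : Module.Basis (Fin n) F (Module.Dual F V)) (l : Module.Dual F V) :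
    MvPolynomial (Fin n) F :=
  ∑ i, MvPolynomial.C (x.repr l i) * MvPolynomial.X i

/-- The action of `GL(V)` on `F[V] = F[x₁, …, xₙ]` by `F`-algebra homomorphisms, which extends
the action on the dual space. -/
def polyAct (x : Module.Basis (Fin n) F (Module.Dual F V))
    (γ : LinearMap.GeneralLinearGroup F V) :
    MvPolynomial (Fin n) F →ₐ[F] MvPolynomial (Fin n) F :=
  MvPolynomial.aeval fun j => linearForm x (dualAct γ (x j))

/-- The ring of invariants `F[V]^Γ`. -/
def invariantRing (x : Module.Basis (Fin n) F (Module.Dual F V))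
    (Γ : Subgroup (LinearMap.GeneralLinearGroup F V)) :
    Subalgebra F (MvPolynomial (Fin n) F) where
  carrier := {f | ∀ γ ∈ Γ, polyAct x γ f = f}
  mul_mem' := fun {f g} hf hg γ hγ => by rw [map_mul, hf γ hγ, hg γ hγ]
  add_mem' := fun {f g} hf hg γ hγ => by rw [map_add, hf γ hγ, hg γ hγ]
  algebraMap_mem' := fun c γ _ => (polyAct x γ).commutes c

/-- `f` is a relative invariant of `Γ` of weight `χ`. -/
def IsRelInvariant (x : Module.Basis (Fin n) F (Module.Dual F V))
    (Γ : Subgroup (LinearMap.GeneralLinearGroup F V)) (χ : Γ →* Fˣ)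
    (f : MvPolynomial (Fin n) F) : Prop :=
  ∀ γ : Γ, polyAct x (γ : LinearMap.GeneralLinearGroup F V) f = ((χ γ : Fˣ) : F) • f

/-- The multiplicative monoid of non-zero relative invariants of `Γ`. -/
def relInvariants (x : Module.Basis (Fin n) F (Module.Dual F V))
    (Γ : Subgroup (LinearMap.GeneralLinearGroup F V)) :
    Submonoid (MvPolynomial (Fin n) F) where
  carrier := {f | f ≠ 0 ∧ ∃ χ : Γ →* Fˣ, IsRelInvariant x Γ χ f}
  one_mem' := ⟨one_ne_zero, 1, fun γ => by simp⟩
  mul_mem' := by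
    rintro f g ⟨hf, χ, hχ⟩ ⟨hg, ψ, hψ⟩
    refine ⟨mul_ne_zero hf hg, χ * ψ, fun γ => ?_⟩
    rw [map_mul, hχ γ, hψ γ, smul_mul_smul_comm]
    rfl

variable (x : Module.Basis (Fin n) F (Module.Dual F V))
  (Γ : Subgroup (LinearMap.GeneralLinearGroup F V))

theorem IsRelInvariant.unique {f : MvPolynomial (Fin n) F} (hf : f ≠ 0) {χ ψ : Γ →* Fˣ}
    (hχ : IsRelInvariant x Γ χ f) (hψ : IsRelInvariant x Γ ψ f) : χ = ψ := by
  ext γ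
  exact smul_left_injective F hf ((hχ γ).symm.trans (hψ γ))

/-- The homomorphism that sends a non-zero relative invariant to its weight. -/
def weight : relInvariants x Γ →* (Γ →* Fˣ) where
  toFun f := f.2.2.choose
  map_one' := IsRelInvariant.unique x Γ one_ne_zero (1 : relInvariants x Γ).2.2.choose_spec
    (fun γ => by simp)
  map_mul' f g := by
    refine IsRelInvariant.unique x Γ (f * g).2.1 (f * g).2.2.choose_spec fun γ => ?_
    have h1 := f.2.2.choose_spec γ
    have h2 := g.2.2.choose_spec γ
    rw [Submonoid.coe_mul, map_mul, h1, h2, smul_mul_smul_comm]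
    rfl

theorem weight_spec (f : relInvariants x Γ) :
    IsRelInvariant x Γ (weight x Γ f) (f : MvPolynomial (Fin n) F) :=
  f.2.2.choose_spec

theorem weight_isUnit {f : relInvariants x Γ} (hf : IsUnit f) : weight x Γ f = 1 := by
  have h : IsUnit (f : MvPolynomial (Fin n) F) := hf.map (relInvariants x Γ).subtype
  obtain ⟨c, -, hc⟩ := MvPolynomial.isUnit_iff_eq_C_of_isReduced.mp h
  refine IsRelInvariant.unique x Γ f.2.1 (weight_spec x Γ f) fun γ => ?_
  rw [hc, MvPolynomial.algHom_C]
  simp [MvPolynomial.algebraMap_eq]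

/-- The reduced monoid `D` of classes (up to units, that is, up to non-zero constants) of
non-zero relative invariants of `Γ`. -/
abbrev RelDiv : Type _ := Associates (relInvariants x Γ)

/-- The weight homomorphism `w : D → Hom(Γ, Fˣ)`. -/
def divWeight : RelDiv x Γ →* (Γ →* Fˣ) where
  toFun := Quotient.lift (fun f => weight x Γ f) (by
    rintro f g ⟨u, rfl⟩
    change weight x Γ f = weight x Γ (f * u)
    rw [map_mul, weight_isUnit x Γ u.isUnit]
    exact (mul_one (weight x Γ f)).symm)
  map_one' := map_one (weight x Γ)
  map_mul' := by
    rintro ⟨f⟩ ⟨g⟩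
    exact map_mul (weight x Γ) f g

theorem divWeight_mk (f : relInvariants x Γ) :
    divWeight x Γ (Associates.mk f) = weight x Γ f := rfl

/-- The submonoid `H ⊆ D` of classes of non-zero invariants of `Γ`. -/
def invDiv : Submonoid (RelDiv x Γ) where
  carrier := {d | ∃ f : relInvariants x Γ,
    (f : MvPolynomial (Fin n) F) ∈ invariantRing x Γ ∧ Associates.mk f = d}
  one_mem' := ⟨1, one_mem _, rfl⟩
  mul_mem' := by
    rintro _ _ ⟨f, hf, rfl⟩ ⟨g, hg, rfl⟩
    exact ⟨f * g, mul_mem hf hg, rfl⟩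

/-- The submonoid `M ⊆ D` of classes of those monomials that are relative invariants of `Γ`
(these are all monomials if every variable is a relative invariant). -/
def monDiv : Submonoid (RelDiv x Γ) where
  carrier := {d | ∃ f : relInvariants x Γ,
    (∃ a : Fin n →₀ ℕ, (f : MvPolynomial (Fin n) F) = MvPolynomial.monomial a 1) ∧
      Associates.mk f = d}
  one_mem' := ⟨1, ⟨0, rfl⟩, rfl⟩
  mul_mem' := by
    rintro _ _ ⟨f, ⟨a, hf⟩, rfl⟩ ⟨g, ⟨b, hg⟩, rfl⟩
    exact ⟨f * g, ⟨a + b, by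
      rw [Submonoid.coe_mul, hf, hg, MvPolynomial.monomial_mul, one_mul]⟩, rfl⟩

/-- The set `D₀ ⊆ D` of all greatest common divisors (in `D`) of finite non-empty subsets
of `H`. -/
def gcdDiv : Set (RelDiv x Γ) :=
  {d | ∃ X : Finset (RelDiv x Γ), X.Nonempty ∧ (X : Set (RelDiv x Γ)) ⊆ invDiv x Γ ∧
    IsGcdOf (X : Set (RelDiv x Γ)) d}

/-- The ramification index `e(q) = min {v_q(h) : h ∈ H, q ∣ h}` of a prime element `q` of `D`,
where `v_q(h)` is the exponent of the highest power of `q` that divides `h` in `D`. -/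
def ramIndex (q : RelDiv x Γ) : ℕ :=
  sInf {k : ℕ | ∃ h ∈ invDiv x Γ, q ∣ h ∧ emultiplicity q h = k}

/-- A pseudoreflection: a non-identity element of `GL(V)` that fixes a hyperplane pointwise and
is not unipotent. -/
def IsPseudoreflection (γ : LinearMap.GeneralLinearGroup F V) : Prop :=
  γ ≠ 1 ∧ (∃ W : Submodule F V, IsCoatom W ∧ ∀ v ∈ W, (γ : V →ₗ[F] V) v = v) ∧
    ¬ IsNilpotent ((γ : V →ₗ[F] V) - LinearMap.id)

/-- The subgroup of `Γ` generated by the pseudoreflections in `Γ`. -/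
def reflectionSubgroup : Subgroup (LinearMap.GeneralLinearGroup F V) :=
  Subgroup.closure {γ | γ ∈ Γ ∧ IsPseudoreflection γ}

/-- The group `Hom⁰(Γ, Fˣ)` of the characters of `Γ` whose kernels contain all
pseudoreflections in `Γ`. -/
def homZero : Subgroup (Γ →* Fˣ) where
  carrier := {χ | ∀ γ : Γ, IsPseudoreflection (γ : LinearMap.GeneralLinearGroup F V) → χ γ = 1}
  one_mem' := fun _ _ => rfl
  mul_mem' := fun {χ ψ} hχ hψ γ hγ => by
    rw [MonoidHom.mul_apply, hχ γ hγ, hψ γ hγ, one_mul]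
  inv_mem' := fun {χ} hχ γ hγ => by rw [MonoidHom.inv_apply, hχ γ hγ, inv_one]

end Action

/-! ### Eigenbases -/

section Eigen

variable {F : Type*} [Field F] {V : Type*} [AddCommGroup V] [Module F V] {n : ℕ}
  {G : Type*} [Group G] {ρ : G →* LinearMap.GeneralLinearGroup F V}
  {x : Module.Basis (Fin n) F (Module.Dual F V)} {χ : Fin n → (G →* Fˣ)}

/-- The basis `x` of the dual space consists of eigenvectors of `G`, and `χᵢ` is the character by
which `G` acts on `xᵢ`. -/
def IsEigenbasis (ρ : G →* LinearMap.GeneralLinearGroup F V)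
    (x : Module.Basis (Fin n) F (Module.Dual F V)) (χ : Fin n → (G →* Fˣ)) : Prop :=
  ∀ (g : G) (i : Fin n), dualAct (ρ g) (x i) = ((χ i g : Fˣ) : F) • x i

theorem IsEigenbasis.ker_le (hx : IsEigenbasis ρ x χ) (i : Fin n) :
    ρ.rangeRestrict.ker ≤ (χ i).ker := by
  intro g hg
  rw [MonoidHom.ker_rangeRestrict, MonoidHom.mem_ker] at hg
  have h := hx g i
  rw [hg] at h
  have h1 : dualAct (1 : LinearMap.GeneralLinearGroup F V) (x i) = x i := by
    ext v
    simp [dualAct]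
  rw [h1] at h
  rw [MonoidHom.mem_ker]
  ext
  refine smul_left_injective F (x.ne_zero i) ?_
  simpa using h.symm

/-- The character `χᵢ` of `G`, viewed as a character of `ρ(G)`. -/
def rangeChar (hx : IsEigenbasis ρ x χ) (i : Fin n) : ρ.range →* Fˣ :=
  ρ.rangeRestrict.liftOfSurjective ρ.rangeRestrict_surjective ⟨χ i, hx.ker_le i⟩

theorem rangeChar_apply (hx : IsEigenbasis ρ x χ) (i : Fin n) (g : G) :
    rangeChar hx i (ρ.rangeRestrict g) = χ i g :=
  MonoidHom.liftOfRightInverse_comp_apply _ _ _ ⟨χ i, hx.ker_le i⟩ g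

theorem IsEigenbasis.isRelInvariant_X (hx : IsEigenbasis ρ x χ) (i : Fin n) :
    IsRelInvariant x ρ.range (rangeChar hx i) (MvPolynomial.X i) := by
  intro γ
  obtain ⟨g, rfl⟩ := ρ.rangeRestrict_surjective γ
  rw [rangeChar_apply, polyAct, MvPolynomial.aeval_X, MonoidHom.coe_rangeRestrict, hx g i,
    linearForm, Finset.sum_eq_single i]
  · simp [MvPolynomial.smul_eq_C_mul]
  · intro j _ hj
    simp [hj.symm]
  · simp

/-- The class of the variable `xᵢ` in the monoid `D` of the group `ρ(G)`. -/
def varDiv (hx : IsEigenbasis ρ x χ) (i : Fin n) : RelDiv x ρ.range :=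
  Associates.mk ⟨MvPolynomial.X i, MvPolynomial.X_ne_zero i, _, hx.isRelInvariant_X i⟩

/-- The number `e(xᵢ)`. -/
def varIndex (hx : IsEigenbasis ρ x χ) (i : Fin n) : ℕ :=
  ramIndex x ρ.range (varDiv hx i)

end Eigen

end

end InvTheory

open InvTheory

namespace InvTheory

noncomputable section

/-! The group ρ(G) acts diagonally: γ multiplies x^a by χ^a(γ) = ∏ χ_i(γ)^(a_i) (`coeff_polyAct`).
So a polynomial is a relative invariant iff all its monomials carry the same character, and every
monomial of an invariant satisfies χ^a = 1.

Let o_i be the order of χ_i modulo the subgroup generated by the other χ_j (`relOrder`). If χ^a = 1,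
then o_i divides a_i. Conversely, the characters have finite order, so inverses are non-negative
powers and some invariant monomial has x_i-exponent exactly o_i; its gcd with a large invariant
power of x_i is x_i^(o_i). Hence e(x_i) = o_i (`varIndex_eq_relOrder`). The x_i-exponent of a
monomial in D₀ is attained in a monomial of some invariant, so M₀ consists of the monomials with
e(x_i) ∣ a_i for all i and is free on the x_i^(e(x_i)) (`powProd_varPow_bijective`). That D₀ is a
monoid reduces to gcds of polynomials, because a gcd of relative invariants is again one
(`exists_gcd_rep`).

Pseudoreflections in ρ(G) are the elements on which exactly one χ_i is non-trivial
(`isPseudoreflection_iff`). By duality of finite abelian groups, χ_i^k lies in the group generated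
by the other χ_j iff it is trivial on their joint kernel. Thus χ^a ∈ Hom⁰ iff e(x_i) ∣ a_i for all i
(`powProd_rangeChar_mem_homZero_iff`). Since every character of ρ(G) is some χ^a, this gives the
generators of Hom⁰, the invariants of G₁, and a surjective weight map M₀ → Hom⁰ whose fibre over 1
is M^G, hence the class group. -/

theorem eq_zero_or_eq_zero_of_add_eq_single_one {ι : Type*} {a b : ι →₀ ℕ} {i : ι} (h : a + b = Finsupp.single i 1) :
    a = 0 ∨ b = 0 := by
  have h1 : a i + b i = 1 := by rw [← Finsupp.add_apply, h, Finsupp.single_eq_same]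
  have h2 : ∀ j, j ≠ i → a j + b j = 0 := fun j hj => by
    rw [← Finsupp.add_apply, h, Finsupp.single_eq_of_ne hj]
  rcases Nat.eq_zero_or_pos (a i) with h0 | h0
  · left
    ext j
    by_cases hj : j = i
    · simp [hj, h0]
    · have := h2 j hj
      simp only [Finsupp.coe_zero, Pi.zero_apply]
      omega
  · right
    ext j
    by_cases hj : j = i
    · simp only [hj, Finsupp.coe_zero, Pi.zero_apply]
      omega
    · have := h2 j hj
      simp only [Finsupp.coe_zero, Pi.zero_apply]
      omega

/-! ### Free abelian monoids on a finite family: divisibility, atoms, primes -/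

section PowProd

variable {ι C : Type*} [CommMonoid C] [Fintype ι] (c : ι → C)

/-- The product of the family `c` with exponents `a`. -/
def powProd (a : ι →₀ ℕ) : C := ∏ i, c i ^ a i

@[simp]
theorem powProd_zero : powProd c 0 = 1 := by simp [powProd]

theorem powProd_add (a b : ι →₀ ℕ) : powProd c (a + b) = powProd c a * powProd c b := by
  simp [powProd, pow_add, Finset.prod_mul_distrib]

theorem powProd_nsmul (m : ℕ) (a : ι →₀ ℕ) : powProd c (m • a) = powProd c a ^ m := by
  simp [powProd, mul_comm m, pow_mul, Finset.prod_pow]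

theorem powProd_single (i : ι) (k : ℕ) : powProd c (Finsupp.single i k) = c i ^ k := by
  classical
  rw [powProd, Finset.prod_eq_single i]
  · simp
  · intro j _ hj
    simp [Finsupp.single_eq_of_ne hj]
  · simp

theorem map_powProd {C' : Type*} [CommMonoid C'] (f : C →* C') (a : ι →₀ ℕ) :
    f (powProd c a) = powProd (fun i => f (c i)) a := by
  simp [powProd]

/-- Unique factorization forces `c` to be injective, so exponents indexed by the range are exponents
indexed by `ι`. -/
theorem isFreeBasis_range_of_bijective (h : Function.Bijective (powProd c)) :
    IsFreeBasis (Set.range c) := by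
  have hc : Function.Injective c := fun i j hij => by
    have h1 := h.1 (a₁ := Finsupp.single i 1) (a₂ := Finsupp.single j 1) (by
      rw [powProd_single, powProd_single, hij])
    exact (Finsupp.single_left_inj one_ne_zero).1 h1
  let e := Equiv.ofInjective c hc
  have h2 : (fun a : Set.range c →₀ ℕ => a.prod fun p k => (p : C) ^ k) =
      powProd c ∘ Finsupp.domCongr (M := ℕ) e.symm := by
    funext a
    have : Fintype (Set.range c) := Fintype.ofEquiv _ e
    rw [Finsupp.prod_fintype _ _ (by simp), Function.comp_apply, powProd, ← e.prod_comp]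
    rfl
  rw [IsFreeBasis, h2]
  exact h.comp (Finsupp.domCongr (M := ℕ) e.symm).bijective

variable {c}

theorem powProd_dvd_powProd_iff (h : Function.Bijective (powProd c)) (a b : ι →₀ ℕ) :
    powProd c a ∣ powProd c b ↔ a ≤ b := by
  constructor
  · rintro ⟨y, hy⟩
    obtain ⟨d, rfl⟩ := h.2 y
    rw [← powProd_add] at hy
    rw [h.1 hy]
    exact le_self_add
  · intro hab
    obtain ⟨d, rfl⟩ := exists_add_of_le hab
    exact ⟨powProd c d, powProd_add c a d⟩

theorem isUnit_powProd_iff (h : Function.Bijective (powProd c)) (a : ι →₀ ℕ) :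
    IsUnit (powProd c a) ↔ a = 0 := by
  rw [isUnit_iff_dvd_one, ← powProd_zero c, powProd_dvd_powProd_iff h, nonpos_iff_eq_zero]

theorem powProd_eq_mul_of_ne_zero {a : ι →₀ ℕ} {i : ι} (hi : a i ≠ 0) :
    powProd c a = c i * powProd c (a - Finsupp.single i 1) := by
  conv_lhs => rw [← add_tsub_cancel_of_le (Finsupp.single_le_iff.2 (Nat.one_le_iff_ne_zero.2 hi))]
  rw [powProd_add, powProd_single, pow_one]

theorem irreducible_iff_mem_range (h : Function.Bijective (powProd c)) (p : C) :
    Irreducible p ↔ p ∈ Set.range c := by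
  have hunit : ∀ i, ¬ IsUnit (c i) := fun i hi => by
    rw [← pow_one (c i), ← powProd_single, isUnit_powProd_iff h] at hi
    simp at hi
  constructor
  · intro hp
    obtain ⟨a, rfl⟩ := h.2 p
    have ha : a ≠ 0 := fun h0 => hp.1 ((isUnit_powProd_iff h a).2 h0)
    obtain ⟨i, hi⟩ := Finsupp.ne_iff.1 ha
    have h1 := powProd_eq_mul_of_ne_zero (c := c) hi
    rcases hp.2 h1 with h2 | h2
    · exact absurd h2 (hunit i)
    · rw [isUnit_powProd_iff h] at h2
      rw [h1, h2, powProd_zero, mul_one]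
      exact ⟨i, rfl⟩
  · rintro ⟨i, rfl⟩
    refine ⟨hunit i, fun y z hyz => ?_⟩
    obtain ⟨a, rfl⟩ := h.2 y
    obtain ⟨b, rfl⟩ := h.2 z
    rw [← powProd_add, ← pow_one (c i), ← powProd_single] at hyz
    rw [isUnit_powProd_iff h, isUnit_powProd_iff h]
    exact eq_zero_or_eq_zero_of_add_eq_single_one (h.1 hyz).symm

theorem isPrimeElement_iff_mem_range (h : Function.Bijective (powProd c)) (p : C) :
    IsPrimeElement p ↔ p ∈ Set.range c := by
  constructor
  · rintro ⟨hp, hdvd⟩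
    obtain ⟨a, rfl⟩ := h.2 p
    obtain ⟨i, hi⟩ := Finsupp.ne_iff.1 (mt (isUnit_powProd_iff h a).2 hp)
    rcases hdvd _ _ (powProd_eq_mul_of_ne_zero (c := c) hi).dvd with h2 | h2
    · rw [← pow_one (c i), ← powProd_single, powProd_dvd_powProd_iff h] at h2
      obtain ⟨b, hb⟩ := exists_add_of_le h2
      rcases eq_zero_or_eq_zero_of_add_eq_single_one hb.symm with h0 | h0
      · simp [h0] at hi
      · rw [h0, add_zero] at hb
        exact ⟨i, by rw [← hb, powProd_single, pow_one]⟩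
    · rw [powProd_dvd_powProd_iff h] at h2
      have h3 := h2 i
      simp only [Finsupp.coe_tsub, Pi.sub_apply, Finsupp.single_eq_same] at h3
      simp only [Finsupp.coe_zero, Pi.zero_apply] at hi
      omega
  · rintro ⟨i, rfl⟩
    refine ⟨((irreducible_iff_mem_range h _).2 ⟨i, rfl⟩).1, fun y z => ?_⟩
    obtain ⟨a, rfl⟩ := h.2 y
    obtain ⟨b, rfl⟩ := h.2 z
    rw [← powProd_add, ← pow_one (c i), ← powProd_single, powProd_dvd_powProd_iff h,
      powProd_dvd_powProd_iff h, powProd_dvd_powProd_iff h, Finsupp.single_le_iff,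
      Finsupp.single_le_iff, Finsupp.single_le_iff, Finsupp.add_apply]
    omega

end PowProd

/-! ### Atoms of divisor-closed submonoids -/

section Submonoids

variable {D : Type*} [CommMonoid D]

theorem atomsOf_subset (T : Submonoid D) : atomsOf T ⊆ T := by
  rintro _ ⟨a, -, rfl⟩
  exact a.2

/-- Factors in `T` of an element of `S` already lie in `S`; likewise inverses, being divisors of 1.
So units and factorizations agree. -/
theorem IsDivisorClosed.atomsOf_eq {S T : Submonoid D} (h : IsDivisorClosed S T) :
    atomsOf S = (S : Set D) ∩ atomsOf T := by
  have hunit : ∀ a : S, IsUnit (⟨a, h.1 a.2⟩ : T) ↔ IsUnit a := by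
    intro a
    rw [isUnit_iff_exists_inv, isUnit_iff_exists_inv]
    constructor
    · rintro ⟨b, hb⟩
      have hb' : (a : D) * b = 1 := congrArg Subtype.val hb
      exact ⟨⟨b, h.2 1 (one_mem S) b b.2 ⟨a, h.1 a.2, by rw [mul_comm, hb']⟩⟩, Subtype.ext hb'⟩
    · rintro ⟨b, hb⟩
      have hb' : (a : D) * b = 1 := congrArg Subtype.val hb
      exact ⟨⟨b, h.1 b.2⟩, Subtype.ext hb'⟩
  ext d
  constructor
  · rintro ⟨a, ha, rfl⟩
    refine ⟨a.2, ⟨a, h.1 a.2⟩, ⟨fun hu => ha.1 ((hunit a).1 hu), fun b c hbc => ?_⟩, rfl⟩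
    have hbc' : (a : D) = b * c := congrArg Subtype.val hbc
    have hb : (b : D) ∈ S := h.2 a a.2 b b.2 ⟨c, c.2, hbc'⟩
    have hc : (c : D) ∈ S := h.2 a a.2 c c.2 ⟨b, b.2, by rw [hbc', mul_comm]⟩
    exact (ha.2 (a := ⟨b, hb⟩) (b := ⟨c, hc⟩) (Subtype.ext hbc')).imp (hunit ⟨b, hb⟩).2
      (hunit ⟨c, hc⟩).2
  · rintro ⟨hd, ⟨a, ha, rfl⟩⟩
    refine ⟨⟨a, hd⟩, ⟨fun hu => ha.1 ((hunit ⟨a, hd⟩).2 hu), fun b c hbc => ?_⟩, rfl⟩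
    have hbc' : (a : D) = b * c := congrArg Subtype.val hbc
    exact (ha.2 (a := ⟨b, h.1 b.2⟩) (b := ⟨c, h.1 c.2⟩) (Subtype.ext hbc')).imp (hunit b).1 (hunit c).1

end Submonoids

/-! ### Class groups from a surjective weight map -/

section ClassGroup

variable {H D A : Type*} [CommMonoid H] [CommMonoid D] [CommGroup A]

/-- The map `w` extends to the quotient group of `D`; the point is that the kernel of the extension
consists of fractions of elements of φ(H). -/
theorem exists_classGroupOf_mulEquiv (φ : H →* D) (w : D →* A) (hw : Function.Surjective w)
    (hker : ∀ d, w d = 1 ↔ d ∈ Set.range φ) :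
    ∃ Φ : ClassGroupOf φ ≃* A, ∀ d, Φ (classOf φ d) = w d := by
  let W : Algebra.GrothendieckGroup D →* A := Algebra.GrothendieckGroup.lift w
  have hW : ∀ d, W (Algebra.GrothendieckGroup.of d) = w d := fun d =>
    DFunLike.congr_fun (Algebra.GrothendieckGroup.lift.symm_apply_apply w) d
  have hWs : Function.Surjective W := fun a => by
    obtain ⟨d, rfl⟩ := hw a
    exact ⟨_, hW d⟩
  have hk : Subgroup.closure (Set.range fun h : H => Algebra.GrothendieckGroup.of (φ h)) =
      W.ker := by
    apply le_antisymm
    · rw [Subgroup.closure_le]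
      rintro _ ⟨h, rfl⟩
      exact (hW _).trans ((hker _).2 ⟨h, rfl⟩)
    · intro z hz
      obtain ⟨⟨m, s⟩, hms⟩ := (Localization.monoidOf (⊤ : Submonoid D)).surj z
      have hms' : z * Algebra.GrothendieckGroup.of (s : D) = Algebra.GrothendieckGroup.of m := hms
      have hwms : w s = w m := by
        rw [← hW, ← hW, ← hms', map_mul, MonoidHom.mem_ker.1 hz, one_mul]
      -- Here z = m/s with w(m) = w(s). Expanding by an element t of inverse weight gives numerator
      -- and denominator weight 1, so both come from `H`.
      obtain ⟨t, ht⟩ := hw (w m)⁻¹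
      obtain ⟨h1, hh1⟩ := (hker (m * t)).1 (by rw [map_mul, ht, mul_inv_cancel])
      obtain ⟨h2, hh2⟩ := (hker (s * t)).1 (by rw [map_mul, ht, hwms, mul_inv_cancel])
      have hz' : z = Algebra.GrothendieckGroup.of (φ h1) *
          (Algebra.GrothendieckGroup.of (φ h2))⁻¹ := by
        rw [eq_mul_inv_iff_mul_eq, hh1, hh2, map_mul, map_mul, ← mul_assoc, hms']
      rw [hz']
      exact mul_mem (Subgroup.subset_closure ⟨h1, rfl⟩)
        (inv_mem (Subgroup.subset_closure ⟨h2, rfl⟩))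
  refine ⟨(QuotientGroup.quotientMulEquivOfEq hk).trans
    (QuotientGroup.quotientKerEquivOfSurjective W hWs), fun d => ?_⟩
  exact hW d

end ClassGroup

/-! ### Order of one group element modulo the others -/

section RelativeOrder

variable {ι C : Type*} [CommGroup C] (c : ι → C)

/-- The order of `c i` modulo the subgroup that the other members of the family generate. -/
def relOrder (i : ι) : ℕ :=
  orderOf (QuotientGroup.mk (c i) : C ⧸ Subgroup.closure (c '' {j | j ≠ i}))

theorem pow_mem_closure_iff_relOrder_dvd (i : ι) (k : ℕ) :
    c i ^ k ∈ Subgroup.closure (c '' {j | j ≠ i}) ↔ relOrder c i ∣ k := by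
  rw [relOrder, orderOf_dvd_iff_pow_eq_one, ← QuotientGroup.mk_pow, QuotientGroup.eq_one_iff]

theorem relOrder_pos (i : ι) (h : IsOfFinOrder (c i)) : 0 < relOrder c i :=
  ((QuotientGroup.mk' (Subgroup.closure (c '' {j | j ≠ i}))).isOfFinOrder h).orderOf_pos

theorem relOrder_map {C' : Type*} [CommGroup C'] (f : C →* C') (hf : Function.Injective f) (i : ι) :
    relOrder (fun j => f (c j)) i = relOrder c i := by
  refine Nat.dvd_right_iff_eq.1 fun k => ?_
  rw [← pow_mem_closure_iff_relOrder_dvd, ← pow_mem_closure_iff_relOrder_dvd, ← map_pow,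
    ← Subgroup.mem_map_iff_mem hf, MonoidHom.map_closure, Set.image_image]

variable [Fintype ι]

theorem powProd_mul_pow_inv_mem (a : ι →₀ ℕ) (i : ι) :
    powProd c a * (c i ^ a i)⁻¹ ∈ Subgroup.closure (c '' {j | j ≠ i}) := by
  classical
  rw [powProd, ← Finset.mul_prod_erase _ _ (Finset.mem_univ i), mul_comm (c i ^ a i),
    mul_inv_cancel_right]
  exact prod_mem fun j hj => pow_mem (Subgroup.subset_closure
    (Set.mem_image_of_mem c (Finset.ne_of_mem_erase hj))) _

/-- A relation expresses `c i ^ a i` as the inverse of a product of powers of the other members. -/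
theorem relOrder_dvd_of_powProd_eq_one {a : ι →₀ ℕ} (h : powProd c a = 1) (i : ι) :
    relOrder c i ∣ a i := by
  have h1 := powProd_mul_pow_inv_mem c a i
  rwa [h, one_mul, inv_mem_iff, pow_mem_closure_iff_relOrder_dvd] at h1

/-- With exponent dividing `N`, y⁻¹ = y^(N-1), so natural exponents suffice. This is what turns
characters into monomials. -/
theorem exists_powProd_eq_of_mem_closure {N : ℕ} (hN : 0 < N) (hc : ∀ y : C, y ^ N = 1)
    (s : Set ι) {y : C} (hy : y ∈ Subgroup.closure (c '' s)) :
    ∃ b : ι →₀ ℕ, (∀ i ∉ s, b i = 0) ∧ powProd c b = y := by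
  induction hy using Subgroup.closure_induction with
  | mem y hy =>
    obtain ⟨j, hj, rfl⟩ := hy
    refine ⟨Finsupp.single j 1, fun i hi => Finsupp.single_eq_of_ne ?_, ?_⟩
    · rintro rfl
      exact hi hj
    · rw [powProd_single, pow_one]
  | one => exact ⟨0, by simp, powProd_zero c⟩
  | mul y z _ _ hy hz =>
    obtain ⟨a, ha, rfl⟩ := hy
    obtain ⟨b, hb, rfl⟩ := hz
    exact ⟨a + b, fun i hi => by simp [ha i hi, hb i hi], powProd_add c a b⟩
  | inv y _ hy =>
    obtain ⟨a, ha, rfl⟩ := hy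
    refine ⟨(N - 1) • a, fun i hi => by simp [ha i hi], ?_⟩
    rw [powProd_nsmul, eq_inv_iff_mul_eq_one, ← pow_succ, Nat.sub_add_cancel hN, hc]

theorem exists_powProd_eq_one {N : ℕ} (hN : 0 < N) (hc : ∀ y : C, y ^ N = 1) (i : ι) :
    ∃ b : ι →₀ ℕ, b i = relOrder c i ∧ powProd c b = 1 := by
  -- Write the inverse of `c i ^ relOrder c i` through the other members, with non-negative
  -- exponents and none at `i`.
  obtain ⟨b, hb, h⟩ := exists_powProd_eq_of_mem_closure c hN hc {j | j ≠ i}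
    (inv_mem ((pow_mem_closure_iff_relOrder_dvd c i _).2 dvd_rfl))
  refine ⟨b + Finsupp.single i (relOrder c i), ?_, ?_⟩
  · simp [hb i (by simp)]
  · rw [powProd_add, h, powProd_single, inv_mul_cancel]

end RelativeOrder

/-! ### Duality for characters of a finite abelian group -/

section Duality

variable {F : Type*} [Field F] [IsAlgClosed F] {G : Type*} [CommGroup G] [Finite G]

/-- A subgroup of the character group is the annihilator of its own annihilator. -/
theorem mem_of_forall_eq_one (hchar : ¬ ringChar F ∣ Nat.card G) (A : Subgroup (G →* Fˣ))
    (ψ : G →* Fˣ) (h : ∀ g : G, (∀ φ ∈ A, φ g = 1) → ψ g = 1) : ψ ∈ A := by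
  -- The exponent is non-zero in `F`, so the algebraically closed field has enough roots of unity
  -- for duality.
  have h0 : (Monoid.exponent G : F) ≠ 0 := fun h =>
    hchar ((ringChar.dvd h).trans Group.exponent_dvd_nat_card)
  have : NeZero (Monoid.exponent G : F) := ⟨h0⟩
  set e := CommGroup.subgroupOrderIsoSubgroupMonoidHom G F
  have h1 : (e (e.symm (OrderDual.toDual A))).ofDual = A := by simp
  rw [← h1, CommGroup.mem_subgroupOrderIsoSubgroupMonoidHom_iff]
  intro g hg
  exact h g ((CommGroup.mem_subgroupOrderIsoSubgroupMonoidHom_symm_iff F A g).1 hg)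

theorem exists_powProd_eq_of_forall {n : ℕ} (hchar : ¬ ringChar F ∣ Nat.card G)
    (χ : Fin n → (G →* Fˣ)) (ψ : G →* Fˣ) (h : ∀ g : G, (∀ i, χ i g = 1) → ψ g = 1) :
    ∃ a : Fin n →₀ ℕ, powProd χ a = ψ := by
  have hψ : ψ ∈ Subgroup.closure (χ '' Set.univ) := by
    refine mem_of_forall_eq_one hchar _ ψ fun g hg => h g fun i => hg _ ?_
    exact Subgroup.subset_closure ⟨i, trivial, rfl⟩
  obtain ⟨a, -, ha⟩ := exists_powProd_eq_of_mem_closure χ (Nat.card_pos (α := G))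
    (fun y => by ext g; simp [← map_pow]) _ hψ
  exact ⟨a, ha⟩

theorem relOrder_dvd_iff_forall {n : ℕ} (hchar : ¬ ringChar F ∣ Nat.card G)
    (χ : Fin n → (G →* Fˣ)) (i : Fin n) (k : ℕ) :
    relOrder χ i ∣ k ↔ ∀ g : G, (∀ j, j ≠ i → χ j g = 1) → χ i g ^ k = 1 := by
  rw [← pow_mem_closure_iff_relOrder_dvd]
  constructor
  · intro h g hg
    have h1 : Subgroup.closure (χ '' {j | j ≠ i}) ≤
        (MonoidHom.eval g : (G →* Fˣ) →* Fˣ).ker := by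
      rw [Subgroup.closure_le]
      rintro _ ⟨j, hj, rfl⟩
      exact hg j hj
    exact h1 h
  · intro h
    refine mem_of_forall_eq_one hchar _ _ fun g hg => h g fun j hj => hg _ ?_
    exact Subgroup.subset_closure ⟨j, hj, rfl⟩

end Duality

/-! ### Divisibility in D and in the polynomial ring -/

section Divisibility

variable {F : Type*} [Field F] {V : Type*} [AddCommGroup V] [Module F V] {n : ℕ}
  {x : Module.Basis (Fin n) F (Module.Dual F V)}
  {Γ : Subgroup (LinearMap.GeneralLinearGroup F V)}

/-- A polynomial quotient of two relative invariants is a relative invariant, of the quotient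
weight. -/
theorem mk_dvd_mk_iff (f g : relInvariants x Γ) :
    Associates.mk f ∣ Associates.mk g ↔
      (f : MvPolynomial (Fin n) F) ∣ (g : MvPolynomial (Fin n) F) := by
  rw [Associates.mk_dvd_mk]
  constructor
  · rintro ⟨q, rfl⟩
    exact ⟨q, rfl⟩
  · rintro ⟨q, hq⟩
    have hf0 := f.2.1
    have hq0 : q ≠ 0 := by
      rintro rfl
      exact g.2.1 (by simpa using hq)
    refine ⟨⟨q, hq0, (weight x Γ f)⁻¹ * weight x Γ g, fun γ => ?_⟩, Subtype.ext hq⟩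
    refine mul_left_cancel₀ hf0 ?_
    have h1 := weight_spec x Γ f γ
    have h2 := weight_spec x Γ g γ
    rw [hq, map_mul, h1, smul_mul_assoc] at h2
    rw [MonoidHom.mul_apply, MonoidHom.inv_apply, Units.val_mul, mul_smul_comm, mul_smul, ← h2,
      smul_smul, Units.inv_mul, one_smul]

/-- A polynomial that represents an element of `D`. -/
def rep (d : RelDiv x Γ) : MvPolynomial (Fin n) F :=
  ((Quotient.out d : relInvariants x Γ) : MvPolynomial (Fin n) F)

theorem exists_mk_eq (d : RelDiv x Γ) :
    ∃ f : relInvariants x Γ, Associates.mk f = d ∧ (f : MvPolynomial (Fin n) F) = rep d :=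
  ⟨Quotient.out d, Quotient.out_eq d, rfl⟩

theorem rep_ne_zero (d : RelDiv x Γ) : rep d ≠ 0 := (Quotient.out d : relInvariants x Γ).2.1

theorem rep_dvd_rep_iff (c d : RelDiv x Γ) : rep c ∣ rep d ↔ c ∣ d := by
  obtain ⟨f, rfl, hf⟩ := exists_mk_eq c
  obtain ⟨g, rfl, hg⟩ := exists_mk_eq d
  rw [← hf, ← hg, mk_dvd_mk_iff]

theorem associated_rep_mk (f : relInvariants x Γ) :
    Associated (rep (Associates.mk f)) (f : MvPolynomial (Fin n) F) := by
  obtain ⟨g, hgf, hg⟩ := exists_mk_eq (Associates.mk f)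
  rw [← hg]
  exact associated_of_dvd_dvd ((mk_dvd_mk_iff g f).1 hgf.dvd) ((mk_dvd_mk_iff f g).1 hgf.symm.dvd)

theorem associated_rep_mul (c d : RelDiv x Γ) : Associated (rep (c * d)) (rep c * rep d) := by
  obtain ⟨f, rfl, hf⟩ := exists_mk_eq c
  obtain ⟨g, rfl, hg⟩ := exists_mk_eq d
  rw [← hf, ← hg]
  exact associated_rep_mk (f * g)

theorem RelDiv.dvd_antisymm {c d : RelDiv x Γ} (h1 : c ∣ d) (h2 : d ∣ c) : c = d := by
  obtain ⟨f, rfl, -⟩ := exists_mk_eq c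
  obtain ⟨g, rfl, -⟩ := exists_mk_eq d
  obtain ⟨q, rfl⟩ := Associates.mk_dvd_mk.1 h1
  obtain ⟨r, hr⟩ := Associates.mk_dvd_mk.1 h2
  have h : q * r = 1 := by
    refine Subtype.ext (mul_left_cancel₀ f.2.1 ?_)
    have h3 := congrArg Subtype.val hr
    simp only [Submonoid.coe_mul] at h3
    rw [Submonoid.coe_mul, ← mul_assoc, ← h3, Submonoid.coe_one, mul_one]
  exact Associates.mk_eq_mk_iff_associated.2 ⟨Units.mkOfMulEqOne q r h, rfl⟩

instance : IsCancelMul (RelDiv x Γ) := by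
  have : ∀ a b c : RelDiv x Γ, a * b ∣ a * c → b ∣ c := by
    intro a b c h
    rw [← rep_dvd_rep_iff, (associated_rep_mul a b).dvd_iff_dvd_left,
      (associated_rep_mul a c).dvd_iff_dvd_right, mul_dvd_mul_iff_left (rep_ne_zero a),
      rep_dvd_rep_iff] at h
    exact h
  have : IsLeftCancelMul (RelDiv x Γ) :=
    ⟨fun a b c h => RelDiv.dvd_antisymm (this a b c (Eq.dvd h)) (this a c b (Eq.dvd (Eq.symm h)))⟩
  exact CommMagma.IsLeftCancelMul.toIsCancelMul _

theorem mem_invDiv_iff (d : RelDiv x Γ) :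
    d ∈ invDiv x Γ ↔ divWeight x Γ d = 1 := by
  constructor
  · rintro ⟨f, hf, rfl⟩
    rw [divWeight_mk]
    refine IsRelInvariant.unique x _ f.2.1 (weight_spec x _ f) fun γ => ?_
    rw [hf γ γ.2]
    simp
  · intro h
    obtain ⟨f, rfl, -⟩ := exists_mk_eq d
    refine ⟨f, fun γ hγ => ?_, rfl⟩
    have h1 := weight_spec x _ f ⟨γ, hγ⟩
    rw [divWeight_mk] at h
    rw [h] at h1
    simpa using h1

end Divisibility

/-! ### The diagonal action and gcds of relative invariants -/

section Eigen

variable {F : Type*} [Field F] {V : Type*} [AddCommGroup V] [Module F V] {n : ℕ}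
  {G : Type*} [Group G] {ρ : G →* LinearMap.GeneralLinearGroup F V}
  {x : Module.Basis (Fin n) F (Module.Dual F V)} {χ : Fin n → (G →* Fˣ)}
  (hx : IsEigenbasis ρ x χ)

include hx

theorem coeff_polyAct (γ : ρ.range) (f : MvPolynomial (Fin n) F) (a : Fin n →₀ ℕ) :
    MvPolynomial.coeff a (polyAct x (γ : LinearMap.GeneralLinearGroup F V) f) =
      ((powProd (rangeChar hx) a γ : Fˣ) : F) * MvPolynomial.coeff a f := by
  induction f using MvPolynomial.induction_on' with
  | monomial b c =>
    have h : polyAct x (γ : LinearMap.GeneralLinearGroup F V) (MvPolynomial.monomial b c) =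
        MvPolynomial.monomial b (((powProd (rangeChar hx) b γ : Fˣ) : F) * c) := by
      have hX : ∀ i, polyAct x (γ : LinearMap.GeneralLinearGroup F V) (MvPolynomial.X i) =
          MvPolynomial.C ((rangeChar hx i γ : Fˣ) : F) * MvPolynomial.X i := fun i => by
        rw [hx.isRelInvariant_X i γ, MvPolynomial.smul_eq_C_mul]
      rw [MvPolynomial.monomial_eq, Finsupp.prod_fintype _ _ (by simp), map_mul, map_prod,
        MvPolynomial.algHom_C, MvPolynomial.monomial_eq, Finsupp.prod_fintype _ _ (by simp)]
      simp_rw [map_pow, hX, mul_pow, Finset.prod_mul_distrib, ← map_pow, ← map_prod,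
        MvPolynomial.algebraMap_eq, map_mul]
      rw [mul_left_comm, mul_assoc]
      congr 3
      simp [powProd, MonoidHom.finsetProd_apply]
    rw [h, MvPolynomial.coeff_monomial, MvPolynomial.coeff_monomial]
    split_ifs with hab
    · rw [hab]
    · rw [mul_zero]
  | add p q hp hq => rw [map_add, MvPolynomial.coeff_add, hp, hq, MvPolynomial.coeff_add, mul_add]

theorem polyAct_eq_smul_iff (γ : ρ.range) (f : MvPolynomial (Fin n) F) (u : Fˣ) :
    polyAct x (γ : LinearMap.GeneralLinearGroup F V) f = (u : F) • f ↔
      ∀ a ∈ f.support, powProd (rangeChar hx) a γ = u := by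
  rw [MvPolynomial.ext_iff]
  refine forall_congr' fun a => ?_
  rw [coeff_polyAct hx, MvPolynomial.coeff_smul, smul_eq_mul, MvPolynomial.mem_support_iff]
  by_cases h : MvPolynomial.coeff a f = 0
  · simp [h]
  · simp [h, Units.ext_iff]

theorem isRelInvariant_iff (ψ : ρ.range →* Fˣ) (f : MvPolynomial (Fin n) F) :
    IsRelInvariant x ρ.range ψ f ↔ ∀ a ∈ f.support, powProd (rangeChar hx) a = ψ := by
  simp only [IsRelInvariant, polyAct_eq_smul_iff hx, MonoidHom.ext_iff]
  exact ⟨fun h a ha γ => h γ a ha, fun h γ a ha => h a ha γ⟩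

/-- Stated as a containment of `Γ` in a kernel so that, for a `Γ` given by generators, it can be
tested on them. -/
theorem mem_invariantRing_iff {Γ : Subgroup (LinearMap.GeneralLinearGroup F V)}
    (hΓ : Γ ≤ ρ.range) (f : MvPolynomial (Fin n) F) :
    f ∈ invariantRing x Γ ↔ ∀ a ∈ f.support,
      Γ ≤ (powProd (rangeChar hx) a).ker.map ρ.range.subtype := by
  have h : f ∈ invariantRing x Γ ↔ ∀ γ ∈ Γ, polyAct x γ f = f := Iff.rfl
  have h1 : ∀ γ : ρ.range, polyAct x (γ : LinearMap.GeneralLinearGroup F V) f = f ↔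
      ∀ a ∈ f.support, powProd (rangeChar hx) a γ = 1 := fun γ => by
    rw [← polyAct_eq_smul_iff hx, Units.val_one, one_smul]
  rw [h]
  constructor
  · intro h a ha γ hγ
    exact ⟨⟨γ, hΓ hγ⟩, (h1 ⟨γ, hΓ hγ⟩).1 (h γ hγ) a ha, rfl⟩
  · intro h γ hγ
    refine (h1 ⟨γ, hΓ hγ⟩).2 fun a ha => ?_
    obtain ⟨δ, hδ, rfl⟩ := h a ha hγ
    exact hδ

/-- Greatest common divisors of relative invariants in the polynomial ring are relative
invariants. -/
theorem exists_gcd_rep (X : Finset (RelDiv x ρ.range)) (hX : X.Nonempty) :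
    ∃ d : RelDiv x ρ.range, ∀ p, p ∣ rep d ↔ ∀ a ∈ X, p ∣ rep a := by
  classical
  let _ : StrongNormalizationMonoid (MvPolynomial (Fin n) F) :=
    UniqueFactorizationMonoid.strongNormalizationMonoid
  let _ := UniqueFactorizationMonoid.toNormalizedGCDMonoid (MvPolynomial (Fin n) F)
  set g := X.gcd rep with hg
  have hdvd : ∀ p, p ∣ g ↔ ∀ a ∈ X, p ∣ rep a := fun p => Finset.dvd_gcd_iff
  have hg0 : g ≠ 0 := by
    obtain ⟨a, ha⟩ := hX
    intro h
    exact rep_ne_zero a (zero_dvd_iff.1 (h ▸ Finset.gcd_dvd ha))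
  -- γg divides γa, a scalar multiple of a, for every a in `X`, so γg ∣ g. The diagonal action keeps
  -- the support and hence the degree, so the cofactor is constant.
  have hact : ∀ γ : ρ.range, ∃ u : Fˣ,
      polyAct x (γ : LinearMap.GeneralLinearGroup F V) g = (u : F) • g := by
    intro γ
    have h1 : polyAct x (γ : LinearMap.GeneralLinearGroup F V) g ∣ g := by
      rw [hdvd]
      intro a ha
      obtain ⟨f, -, hf⟩ := exists_mk_eq a
      have h2 := map_dvd (polyAct x (γ : LinearMap.GeneralLinearGroup F V))
        ((hdvd g).1 dvd_rfl a ha)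
      rw [← hf, weight_spec x _ f γ, MvPolynomial.smul_eq_C_mul] at h2
      rw [← hf]
      exact (((weight x _ f γ).isUnit.map MvPolynomial.C).dvd_mul_left).1 h2
    have hsupp : (polyAct x (γ : LinearMap.GeneralLinearGroup F V) g).support = g.support := by
      ext a
      rw [MvPolynomial.mem_support_iff, MvPolynomial.mem_support_iff, coeff_polyAct hx]
      simp
    obtain ⟨q, hq⟩ := h1
    have hp0 : polyAct x (γ : LinearMap.GeneralLinearGroup F V) g ≠ 0 := by
      intro h
      exact hg0 (by rw [hq, h, zero_mul])
    have hq0 : q ≠ 0 := by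
      rintro rfl
      exact hg0 (by rw [hq, mul_zero])
    have hdeg : q.totalDegree = 0 := by
      have h2 := MvPolynomial.totalDegree_mul_of_isDomain hp0 hq0
      have h3 : (polyAct x (γ : LinearMap.GeneralLinearGroup F V) g).totalDegree =
          g.totalDegree := by
        rw [MvPolynomial.totalDegree, hsupp, MvPolynomial.totalDegree]
      rw [← hq, h3] at h2
      omega
    rw [MvPolynomial.totalDegree_eq_zero_iff_eq_C] at hdeg
    have hc : MvPolynomial.coeff 0 q ≠ 0 := by
      intro h
      rw [h, map_zero] at hdeg
      exact hq0 hdeg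
    refine ⟨(Units.mk0 _ hc)⁻¹, ?_⟩
    have h4 : g = MvPolynomial.coeff 0 q • polyAct x (γ : LinearMap.GeneralLinearGroup F V) g := by
      rw [MvPolynomial.smul_eq_C_mul, ← hdeg, mul_comm, ← hq]
    conv_rhs => rw [h4]
    rw [smul_smul, Units.val_inv_eq_inv_val, Units.val_mk0, inv_mul_cancel₀ hc, one_smul]
  have hrel : g ∈ relInvariants x ρ.range := by
    refine ⟨hg0, ?_⟩
    obtain ⟨a, ha⟩ := MvPolynomial.support_nonempty.2 hg0
    -- The scalars depend on γ a priori without structure; any monomial of g reads them off as one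
    -- character.
    refine ⟨powProd (rangeChar hx) a, fun γ => ?_⟩
    obtain ⟨u, hu⟩ := hact γ
    rw [(polyAct_eq_smul_iff hx γ g u).1 hu a ha, hu]
  refine ⟨Associates.mk ⟨g, hrel⟩, fun p => ?_⟩
  rw [(associated_rep_mk _).dvd_iff_dvd_right, ← hdvd]

/-- A gcd taken in D tests only relative invariants; since the polynomial gcd is one, it is a gcd
against all polynomials. -/
theorem isGcdOf_iff (X : Finset (RelDiv x ρ.range)) (hX : X.Nonempty) (d : RelDiv x ρ.range) :
    IsGcdOf (X : Set (RelDiv x ρ.range)) d ↔ ∀ p, p ∣ rep d ↔ ∀ a ∈ X, p ∣ rep a := by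
  constructor
  · rintro ⟨h1, h2⟩ p
    constructor
    · exact fun h a ha => h.trans ((rep_dvd_rep_iff _ _).2 (h1 a ha))
    · intro h
      obtain ⟨g, hg⟩ := exists_gcd_rep hx X hX
      refine ((hg p).2 h).trans ((rep_dvd_rep_iff _ _).2 (h2 g fun a ha => ?_))
      exact (rep_dvd_rep_iff _ _).1 ((hg _).1 dvd_rfl a ha)
  · intro h
    refine ⟨fun a ha => (rep_dvd_rep_iff _ _).1 ((h _).1 dvd_rfl a ha), fun c hc => ?_⟩
    exact (rep_dvd_rep_iff _ _).1 ((h _).2 fun a ha => (rep_dvd_rep_iff _ _).2 (hc a ha))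

theorem IsGcdOf.mul_left {X : Finset (RelDiv x ρ.range)} (hX : X.Nonempty) {d : RelDiv x ρ.range}
    (h : IsGcdOf (X : Set (RelDiv x ρ.range)) d) {z c : RelDiv x ρ.range}
    (hc : ∀ a ∈ X, c ∣ z * a) : c ∣ z * d := by
  classical
  let _ : StrongNormalizationMonoid (MvPolynomial (Fin n) F) :=
    UniqueFactorizationMonoid.strongNormalizationMonoid
  let _ := UniqueFactorizationMonoid.toNormalizedGCDMonoid (MvPolynomial (Fin n) F)
  rw [isGcdOf_iff hx X hX] at h
  have h1 : X.gcd rep ∣ rep d := (h _).2 fun a ha => Finset.gcd_dvd ha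
  rw [← rep_dvd_rep_iff, (associated_rep_mul z d).dvd_iff_dvd_right]
  refine dvd_trans ?_ (mul_dvd_mul_left _ h1)
  rw [← (Finset.gcd_mul_left' _ _ (rep z)).dvd_iff_dvd_right, Finset.dvd_gcd_iff]
  intro a ha
  rw [← (associated_rep_mul z a).dvd_iff_dvd_right, rep_dvd_rep_iff]
  exact hc a ha

/-- The greatest common divisors of finite non-empty sets of invariants form a submonoid. -/
def gcdSubmonoid : Submonoid (RelDiv x ρ.range) where
  carrier := gcdDiv x ρ.range
  one_mem' := ⟨{1}, by simp, by simp [one_mem], by simp, by simp⟩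
  mul_mem' := by
    classical
    rintro d e ⟨X, hX, hXH, hd⟩ ⟨Y, hY, hYH, he⟩
    -- gcd(X)·gcd(Y) = gcd(XY), by distributing first over `Y` and then over `X`.
    refine ⟨Finset.image₂ (· * ·) X Y, hX.image₂ hY, ?_, ?_, ?_⟩
    · rw [Finset.coe_image₂, Set.image2_subset_iff]
      exact fun a ha b hb => mul_mem (hXH ha) (hYH hb)
    · rw [Finset.coe_image₂, Set.forall_mem_image2]
      exact fun a ha b hb => mul_dvd_mul (hd.1 a ha) (he.1 b hb)
    · intro c hc
      rw [Finset.coe_image₂, Set.forall_mem_image2] at hc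
      refine IsGcdOf.mul_left hx hY he fun b hb => ?_
      rw [mul_comm]
      refine IsGcdOf.mul_left hx hX hd fun a ha => ?_
      rw [mul_comm]
      exact hc a ha b hb

end Eigen

/-! ### Monomials in D, ramification indices and the monoid M₀ -/

theorem monomial_one_dvd_iff {σ R : Type*} [CommSemiring R] (a : σ →₀ ℕ)
    (f : MvPolynomial σ R) :
    MvPolynomial.monomial a 1 ∣ f ↔ ∀ b ∈ f.support, a ≤ b := by
  rw [MvPolynomial.monomial_one_dvd_iff_modMonomial_eq_zero, MvPolynomial.ext_iff]
  refine forall_congr' fun b => ?_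
  rw [MvPolynomial.coeff_zero, MvPolynomial.mem_support_iff]
  by_cases hab : a ≤ b
  · simp [hab]
  · simp [hab]

theorem finsupp_le_single_of_le {ι : Type*} {i : ι} {m b : ι →₀ ℕ} {K : ℕ} (h1 : m ≤ b)
    (h2 : m ≤ Finsupp.single i K) : m ≤ Finsupp.single i (b i) := by
  classical
  intro j
  by_cases hj : j = i
  · rw [hj, Finsupp.single_eq_same]
    exact h1 i
  · have h3 := h2 j
    rw [Finsupp.single_eq_of_ne hj] at h3 ⊢
    exact h3

section Monomials

variable {F : Type*} [Field F] {V : Type*} [AddCommGroup V] [Module F V] {n : ℕ}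
  {G : Type*} [Group G] {ρ : G →* LinearMap.GeneralLinearGroup F V}
  {x : Module.Basis (Fin n) F (Module.Dual F V)} {χ : Fin n → (G →* Fˣ)}
  (hx : IsEigenbasis ρ x χ)

theorem isRelInvariant_monomial (a : Fin n →₀ ℕ) :
    IsRelInvariant x ρ.range (powProd (rangeChar hx) a) (MvPolynomial.monomial a 1) := by
  rw [isRelInvariant_iff hx]
  intro b hb
  rw [Finset.mem_singleton.1 (MvPolynomial.support_monomial_subset hb)]

/-- The class of the monomial with exponent vector `a` in `D`. -/
def monomialDiv (a : Fin n →₀ ℕ) : RelDiv x ρ.range :=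
  Associates.mk ⟨MvPolynomial.monomial a 1, by simp, _, isRelInvariant_monomial hx a⟩

theorem associated_rep_monomialDiv (a : Fin n →₀ ℕ) :
    Associated (rep (monomialDiv hx a)) (MvPolynomial.monomial a (1 : F)) :=
  associated_rep_mk _

theorem monomialDiv_zero : monomialDiv hx 0 = 1 := rfl

theorem monomialDiv_add (a b : Fin n →₀ ℕ) :
    monomialDiv hx (a + b) = monomialDiv hx a * monomialDiv hx b := by
  refine congrArg Associates.mk (Subtype.ext ?_)
  rw [Submonoid.coe_mul, MvPolynomial.monomial_mul, one_mul]

theorem monomialDiv_single (i : Fin n) (k : ℕ) :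
    monomialDiv hx (Finsupp.single i k) = varDiv hx i ^ k := by
  induction k with
  | zero => rw [Finsupp.single_zero, monomialDiv_zero, pow_zero]
  | succ k ih =>
    rw [Finsupp.single_add, monomialDiv_add, ih, pow_succ]
    rfl

theorem monomialDiv_eq_powProd (a : Fin n →₀ ℕ) : monomialDiv hx a = powProd (varDiv hx) a := by
  classical
  induction a using Finsupp.induction_linear with
  | zero => rw [monomialDiv_zero, powProd_zero]
  | add a b ha hb => rw [monomialDiv_add, powProd_add, ha, hb]
  | single i k => rw [monomialDiv_single, powProd_single]

theorem mem_monDiv_iff (d : RelDiv x ρ.range) :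
    d ∈ monDiv x ρ.range ↔ ∃ a, monomialDiv hx a = d := by
  constructor
  · rintro ⟨f, ⟨a, hf⟩, rfl⟩
    exact ⟨a, congrArg Associates.mk (Subtype.ext hf.symm)⟩
  · rintro ⟨a, rfl⟩
    exact ⟨_, ⟨a, rfl⟩, rfl⟩

theorem monomialDiv_dvd_iff (a : Fin n →₀ ℕ) (d : RelDiv x ρ.range) :
    monomialDiv hx a ∣ d ↔ ∀ b ∈ (rep d).support, a ≤ b := by
  rw [← rep_dvd_rep_iff, (associated_rep_monomialDiv hx a).dvd_iff_dvd_left, monomial_one_dvd_iff]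

theorem monomialDiv_dvd_monomialDiv_iff (a b : Fin n →₀ ℕ) :
    monomialDiv hx a ∣ monomialDiv hx b ↔ a ≤ b := by
  rw [← rep_dvd_rep_iff, (associated_rep_monomialDiv hx a).dvd_iff_dvd_left,
    (associated_rep_monomialDiv hx b).dvd_iff_dvd_right,
    MvPolynomial.monomial_one_dvd_monomial_one]

theorem monomialDiv_injective : Function.Injective (monomialDiv hx) := fun a b h =>
  le_antisymm ((monomialDiv_dvd_monomialDiv_iff hx a b).1 h.dvd)
    ((monomialDiv_dvd_monomialDiv_iff hx b a).1 h.symm.dvd)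

/-- Polynomial divisors of a monomial are monomials up to constants, so M is divisor closed in D. -/
theorem exists_monomialDiv_eq_of_dvd {d : RelDiv x ρ.range} {b : Fin n →₀ ℕ}
    (h : d ∣ monomialDiv hx b) : ∃ a, a ≤ b ∧ monomialDiv hx a = d := by
  rw [← rep_dvd_rep_iff, (associated_rep_monomialDiv hx b).dvd_iff_dvd_right,
    MvPolynomial.dvd_monomial_one_iff_exists] at h
  obtain ⟨a, u, hab, hu, hd⟩ := h
  have h1 : Associated (rep (monomialDiv hx a)) (rep d) := by
    refine (associated_rep_monomialDiv hx a).trans ?_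
    rw [hd, ← mul_one u, ← MvPolynomial.C_mul_monomial, mul_comm]
    exact associated_mul_unit_right _ _ (hu.map MvPolynomial.C)
  exact ⟨a, hab, RelDiv.dvd_antisymm ((rep_dvd_rep_iff _ _).1 h1.dvd)
    ((rep_dvd_rep_iff _ _).1 h1.symm.dvd)⟩

theorem divWeight_monomialDiv (a : Fin n →₀ ℕ) :
    divWeight x ρ.range (monomialDiv hx a) = powProd (rangeChar hx) a :=
  IsRelInvariant.unique x _ (by simp) (weight_spec x _ _) (isRelInvariant_monomial hx a)

theorem powProd_eq_one_of_mem_invDiv {d : RelDiv x ρ.range} (hd : d ∈ invDiv x ρ.range)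
    {a : Fin n →₀ ℕ} (ha : a ∈ (rep d).support) : powProd (rangeChar hx) a = 1 := by
  rw [mem_invDiv_iff] at hd
  obtain ⟨f, rfl, hf⟩ := exists_mk_eq d
  rw [divWeight_mk] at hd
  have h := weight_spec x _ f
  rw [hd, isRelInvariant_iff hx, hf] at h
  exact h a ha

theorem relOrder_dvd_of_mem_invDiv {d : RelDiv x ρ.range} (hd : d ∈ invDiv x ρ.range)
    {a : Fin n →₀ ℕ} (ha : a ∈ (rep d).support) (i : Fin n) :
    relOrder (rangeChar hx) i ∣ a i :=
  relOrder_dvd_of_powProd_eq_one _ (powProd_eq_one_of_mem_invDiv hx hd ha) i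

/-- The multiplicity of x_i is the least x_i-exponent in the support, and it is attained. -/
theorem exists_apply_eq_of_emultiplicity_eq {i : Fin n} {d : RelDiv x ρ.range} {k : ℕ}
    (h : emultiplicity (varDiv hx i) d = k) : ∃ a ∈ (rep d).support, a i = k := by
  rw [emultiplicity_eq_coe, ← monomialDiv_single, ← monomialDiv_single, monomialDiv_dvd_iff,
    monomialDiv_dvd_iff] at h
  obtain ⟨h1, h2⟩ := h
  push Not at h2
  obtain ⟨a, ha, h3⟩ := h2
  have h4 := Finsupp.single_le_iff.1 (h1 a ha)
  rw [Finsupp.single_le_iff] at h3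
  exact ⟨a, ha, by omega⟩

theorem emultiplicity_monomialDiv (i : Fin n) (a : Fin n →₀ ℕ) :
    emultiplicity (varDiv hx i) (monomialDiv hx a) = a i := by
  rw [emultiplicity_eq_coe, ← monomialDiv_single, ← monomialDiv_single,
    monomialDiv_dvd_monomialDiv_iff, monomialDiv_dvd_monomialDiv_iff, Finsupp.single_le_iff,
    Finsupp.single_le_iff]
  omega

theorem varDiv_dvd_monomialDiv_iff (i : Fin n) (a : Fin n →₀ ℕ) :
    varDiv hx i ∣ monomialDiv hx a ↔ 0 < a i := by
  rw [← pow_one (varDiv hx i), ← monomialDiv_single, monomialDiv_dvd_monomialDiv_iff,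
    Finsupp.single_le_iff, Nat.succ_le_iff]

theorem relOrder_dvd_of_monomialDiv_mem_gcdDiv {a : Fin n →₀ ℕ}
    (h : monomialDiv hx a ∈ gcdDiv x ρ.range) (i : Fin n) : relOrder (rangeChar hx) i ∣ a i := by
  obtain ⟨X, -, hXH, hX⟩ := h
  -- x_i^(a_i+1) does not divide the gcd, so it misses some member of `X`. A monomial of that member
  -- has x_i-exponent at most a_i, and at least a_i since the gcd divides it.
  have h1 : ¬ monomialDiv hx (Finsupp.single i (a i + 1)) ∣ monomialDiv hx a := by
    rw [monomialDiv_dvd_monomialDiv_iff, Finsupp.single_le_iff]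
    omega
  have h2 := mt (hX.2 _) h1
  push Not at h2
  obtain ⟨d, hd, h3⟩ := h2
  rw [monomialDiv_dvd_iff] at h3
  push Not at h3
  obtain ⟨b, hb, h4⟩ := h3
  rw [Finsupp.single_le_iff] at h4
  have h5 := (monomialDiv_dvd_iff hx a d).1 (hX.1 d hd) b hb i
  have h6 := relOrder_dvd_of_mem_invDiv hx (hXH hd) hb i
  rwa [show a i = b i by omega]

/-- The greatest common divisor of a monomial and a power of a variable. -/
theorem isGcdOf_monomialDiv_pair (i : Fin n) (b : Fin n →₀ ℕ) {K : ℕ} (hK : b i ≤ K) :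
    IsGcdOf {monomialDiv hx b, monomialDiv hx (Finsupp.single i K)} (varDiv hx i ^ b i) := by
  rw [← monomialDiv_single]
  constructor
  · rintro _ (rfl | rfl)
    · rw [monomialDiv_dvd_monomialDiv_iff, Finsupp.single_le_iff]
    · rwa [monomialDiv_dvd_monomialDiv_iff, Finsupp.single_le_iff, Finsupp.single_eq_same]
  · intro c hc
    have h1 := hc _ (Or.inl rfl)
    have h2 := hc _ (Or.inr rfl)
    obtain ⟨a, hab, rfl⟩ := exists_monomialDiv_eq_of_dvd hx h1
    rw [monomialDiv_dvd_monomialDiv_iff] at h2 ⊢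
    exact finsupp_le_single_of_le hab h2

theorem monomialDiv_mem_invDiv_iff (a : Fin n →₀ ℕ) :
    monomialDiv hx a ∈ invDiv x ρ.range ↔ powProd (rangeChar hx) a = 1 := by
  rw [mem_invDiv_iff, divWeight_monomialDiv]

/-- The exponent vectors `(eᵢ aᵢ)ᵢ`. -/
def scale (e : Fin n → ℕ) (a : Fin n →₀ ℕ) : Fin n →₀ ℕ :=
  Finsupp.equivFunOnFinite.symm fun i => e i * a i

theorem powProd_pow {C : Type*} [CommMonoid C] (c : Fin n → C) (e : Fin n → ℕ)
    (a : Fin n →₀ ℕ) : powProd (fun i => c i ^ e i) a = powProd c (scale e a) := by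
  simp [powProd, scale, pow_mul]

theorem exists_scale_eq {e : Fin n → ℕ} {a : Fin n →₀ ℕ} (h : ∀ i, e i ∣ a i) :
    ∃ b, scale e b = a := by
  choose b hb using h
  refine ⟨Finsupp.equivFunOnFinite.symm b, ?_⟩
  ext i
  simp [scale, hb i]

theorem scale_le_scale_iff {e : Fin n → ℕ} (he : ∀ i, 0 < e i) (a b : Fin n →₀ ℕ) :
    scale e a ≤ scale e b ↔ a ≤ b := by
  simp only [Finsupp.le_def, scale, Finsupp.equivFunOnFinite_symm_apply_apply]
  exact forall_congr' fun i => Nat.mul_le_mul_left_iff (he i)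

theorem rangeChar_pow_card (y : ρ.range →* Fˣ) : y ^ Nat.card ρ.range = 1 := by
  ext γ
  rw [MonoidHom.pow_apply, ← map_pow, pow_card_eq_one']
  simp

/-- The monoid `M₀` of monomials that are greatest common divisors of invariants. -/
def gcdMonomials : Submonoid (RelDiv x ρ.range) := monDiv x ρ.range ⊓ gcdSubmonoid hx

theorem isDivisorClosed_gcdMonomials : IsDivisorClosed (gcdMonomials hx) (gcdSubmonoid hx) := by
  refine ⟨inf_le_right, ?_⟩
  rintro a ⟨haM, -⟩ b hb ⟨c, -, rfl⟩
  obtain ⟨m, hm⟩ := (mem_monDiv_iff hx _).1 haM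
  obtain ⟨k, -, hk⟩ := exists_monomialDiv_eq_of_dvd hx (d := b) (b := m) ⟨c, hm⟩
  exact ⟨(mem_monDiv_iff hx b).2 ⟨k, hk⟩, hb⟩

theorem invariantMonomials_le : monDiv x ρ.range ⊓ invDiv x ρ.range ≤ gcdMonomials hx := by
  rintro d ⟨hM, hH⟩
  exact ⟨hM, {d}, by simp, by simpa using hH, by simp, by simp⟩

variable [Finite ρ.range]

theorem relOrder_rangeChar_pos (i : Fin n) : 0 < relOrder (rangeChar hx) i :=
  relOrder_pos _ i (isOfFinOrder_iff_pow_eq_one.2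
    ⟨Nat.card ρ.range, Nat.card_pos, rangeChar_pow_card _⟩)

/-- Supplies two invariants whose gcd is the power of x_i with exponent `relOrder`. -/
theorem exists_invariant_monomials (i : Fin n) :
    ∃ (b : Fin n →₀ ℕ) (K : ℕ), b i = relOrder (rangeChar hx) i ∧ b i ≤ K ∧
      monomialDiv hx b ∈ invDiv x ρ.range ∧
      monomialDiv hx (Finsupp.single i K) ∈ invDiv x ρ.range := by
  obtain ⟨b, hb, h⟩ := exists_powProd_eq_one (rangeChar hx) (Nat.card_pos (α := ρ.range))
    rangeChar_pow_card i
  -- A multiple of the group order makes the pure power invariant; having the factor b_i keeps it at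
  -- least b_i.
  refine ⟨b, b i * Nat.card ρ.range, hb, Nat.le_mul_of_pos_right _ Nat.card_pos,
    (monomialDiv_mem_invDiv_iff hx b).2 h, (monomialDiv_mem_invDiv_iff hx _).2 ?_⟩
  rw [powProd_single, pow_mul, rangeChar_pow_card]

theorem varIndex_eq_relOrder (i : Fin n) : varIndex hx i = relOrder (rangeChar hx) i := by
  obtain ⟨b, K, hb, -, hbH, -⟩ := exists_invariant_monomials hx i
  have hmem : relOrder (rangeChar hx) i ∈ {k : ℕ | ∃ h ∈ invDiv x ρ.range, varDiv hx i ∣ h ∧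
      emultiplicity (varDiv hx i) h = k} := by
    refine ⟨_, hbH, ?_, ?_⟩
    · rw [varDiv_dvd_monomialDiv_iff, hb]
      exact relOrder_rangeChar_pos hx i
    · rw [emultiplicity_monomialDiv, hb]
  refine le_antisymm (Nat.sInf_le hmem) (le_csInf ⟨_, hmem⟩ ?_)
  rintro k ⟨h, hH, hdvd, hk⟩
  obtain ⟨a, ha, rfl⟩ := exists_apply_eq_of_emultiplicity_eq hx hk
  refine Nat.le_of_dvd ?_ (relOrder_dvd_of_mem_invDiv hx hH ha i)
  -- The condition x_i ∣ h excludes exponent 0, for which divisibility by `relOrder` would give no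
  -- bound.
  rw [← pow_one (varDiv hx i), ← monomialDiv_single, monomialDiv_dvd_iff] at hdvd
  exact Finsupp.single_le_iff.1 (hdvd a ha)

theorem varIndex_pos (i : Fin n) : 0 < varIndex hx i :=
  varIndex_eq_relOrder hx i ▸ relOrder_rangeChar_pos hx i

theorem varDiv_pow_mem_gcdSubmonoid (i : Fin n) :
    varDiv hx i ^ varIndex hx i ∈ gcdSubmonoid hx := by
  classical
  obtain ⟨b, K, hb, hK, hbH, hKH⟩ := exists_invariant_monomials hx i
  refine ⟨{monomialDiv hx b, monomialDiv hx (Finsupp.single i K)}, by simp, ?_, ?_⟩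
  · rw [Finset.coe_pair, Set.pair_subset_iff]
    exact ⟨hbH, hKH⟩
  · rw [Finset.coe_pair, varIndex_eq_relOrder, ← hb]
    exact isGcdOf_monomialDiv_pair hx i b hK

/-- The power `xᵢ ^ e(xᵢ)` as an element of `M₀`. -/
def varPow (i : Fin n) : gcdMonomials hx :=
  ⟨varDiv hx i ^ varIndex hx i, (mem_monDiv_iff hx _).2 ⟨_, monomialDiv_single hx i _⟩,
    varDiv_pow_mem_gcdSubmonoid hx i⟩

theorem coe_varPow (i : Fin n) :
    (varPow hx i : RelDiv x ρ.range) = varDiv hx i ^ varIndex hx i := rfl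

theorem coe_powProd_varPow (a : Fin n →₀ ℕ) :
    ((powProd (varPow hx) a : gcdMonomials hx) : RelDiv x ρ.range) =
      monomialDiv hx (scale (varIndex hx) a) := by
  rw [← Submonoid.subtype_apply, map_powProd, monomialDiv_eq_powProd, ← powProd_pow]
  rfl

theorem powProd_varPow_bijective : Function.Bijective (powProd (varPow hx)) := by
  constructor
  · intro a b hab
    have h := congrArg Subtype.val hab
    rw [coe_powProd_varPow, coe_powProd_varPow] at h
    have h1 := monomialDiv_injective hx h
    exact le_antisymm ((scale_le_scale_iff (varIndex_pos hx) _ _).1 h1.le)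
      ((scale_le_scale_iff (varIndex_pos hx) _ _).1 h1.ge)
  · rintro ⟨d, hdM, hd⟩
    obtain ⟨a, rfl⟩ := (mem_monDiv_iff hx d).1 hdM
    obtain ⟨b, rfl⟩ := exists_scale_eq (e := varIndex hx) (a := a) fun i => by
      rw [varIndex_eq_relOrder]
      exact relOrder_dvd_of_monomialDiv_mem_gcdDiv hx hd i
    exact ⟨b, Subtype.ext (coe_powProd_varPow hx b)⟩

/-- Both sides compare exponent vectors, before or after scaling by the positive e(x_i). It
transfers gcds from D to M₀. -/
theorem gcdMonomials_dvd_iff (c d : gcdMonomials hx) :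
    c ∣ d ↔ (c : RelDiv x ρ.range) ∣ (d : RelDiv x ρ.range) := by
  obtain ⟨a, rfl⟩ := (powProd_varPow_bijective hx).2 c
  obtain ⟨b, rfl⟩ := (powProd_varPow_bijective hx).2 d
  rw [powProd_dvd_powProd_iff (powProd_varPow_bijective hx), coe_powProd_varPow,
    coe_powProd_varPow, monomialDiv_dvd_monomialDiv_iff, scale_le_scale_iff (varIndex_pos hx)]

theorem atomsOf_gcdMonomials :
    atomsOf (gcdMonomials hx) = Set.range fun i => varDiv hx i ^ varIndex hx i := by
  have h : {a : gcdMonomials hx | Irreducible a} = Set.range (varPow hx) :=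
    Set.ext fun p => irreducible_iff_mem_range (powProd_varPow_bijective hx) p
  rw [atomsOf, h, ← Set.range_comp]
  rfl

theorem isDivisorTheory_invariantMonomials :
    IsDivisorTheory (Submonoid.inclusion (invariantMonomials_le hx)) := by
  classical
  constructor
  · rintro a b ⟨c, hc⟩
    have hc' : (b : RelDiv x ρ.range) = a * c := congrArg Subtype.val hc
    -- Weights are multiplicative, so a cofactor between invariants has weight 1.
    have hcH : (c : RelDiv x ρ.range) ∈ invDiv x ρ.range := by
      have h := congrArg (divWeight x ρ.range) hc'
      rw [map_mul, (mem_invDiv_iff _).1 a.2.2, (mem_invDiv_iff _).1 b.2.2] at h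
      exact (mem_invDiv_iff _).2 ((one_mul _).symm.trans h.symm)
    exact ⟨⟨c, c.2.1, hcH⟩, Subtype.ext hc'⟩
  · refine ⟨_, isFreeBasis_range_of_bijective _ (powProd_varPow_bijective hx), ?_⟩
    rintro _ ⟨i, rfl⟩
    obtain ⟨b, K, hb, hK, hbH, hKH⟩ := exists_invariant_monomials hx i
    have hg := isGcdOf_monomialDiv_pair hx i b hK
    rw [hb, ← varIndex_eq_relOrder] at hg
    refine ⟨{⟨_, (mem_monDiv_iff hx _).2 ⟨b, rfl⟩, hbH⟩,
      ⟨_, (mem_monDiv_iff hx _).2 ⟨Finsupp.single i K, rfl⟩, hKH⟩}, by simp, ?_⟩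
    rw [Finset.coe_pair, Set.image_pair]
    constructor
    · rintro _ (rfl | rfl)
      · exact (gcdMonomials_dvd_iff hx _ _).2 (hg.1 _ (Or.inl rfl))
      · exact (gcdMonomials_dvd_iff hx _ _).2 (hg.1 _ (Or.inr rfl))
    · intro c hc
      rw [gcdMonomials_dvd_iff]
      refine hg.2 _ ?_
      rintro _ (rfl | rfl)
      · exact (gcdMonomials_dvd_iff hx _ _).1 (hc _ (Or.inl rfl))
      · exact (gcdMonomials_dvd_iff hx _ _).1 (hc _ (Or.inr rfl))

end Monomials

/-! ### Pseudoreflections in coordinates -/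

section Pseudoreflections

variable {F : Type*} [Field F] {V : Type*} [AddCommGroup V] [Module F V] {n : ℕ}
  {G : Type*} [Group G] {ρ : G →* LinearMap.GeneralLinearGroup F V}
  {x : Module.Basis (Fin n) F (Module.Dual F V)} {χ : Fin n → (G →* Fˣ)}

theorem eq_zero_of_basis_dual_apply_eq_zero (x : Module.Basis (Fin n) F (Module.Dual F V)) {v : V}
    (h : ∀ i, x i v = 0) : v = 0 := by
  rw [← Module.forall_dual_apply_eq_zero_iff F v]
  intro f
  rw [← x.sum_repr f, LinearMap.sum_apply]
  exact Finset.sum_eq_zero fun i _ => by rw [LinearMap.smul_apply, h i, smul_zero]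

theorem exists_basis_dual_apply_ne_zero (x : Module.Basis (Fin n) F (Module.Dual F V))
    (i : Fin n) : ∃ v, x i v ≠ 0 := by
  by_contra! h
  exact x.ne_zero i (LinearMap.ext h)

theorem isCoatom_ker_basis_dual (x : Module.Basis (Fin n) F (Module.Dual F V)) (i : Fin n) :
    IsCoatom (LinearMap.ker (x i)) :=
  LinearMap.isCoatom_ker_of_surjective (LinearMap.surjective (x.ne_zero i))

variable (hx : IsEigenbasis ρ x χ)

theorem basis_dual_apply_apply (γ : ρ.range) (i : Fin n) (v : V) :
    x i (((γ : LinearMap.GeneralLinearGroup F V) : V →ₗ[F] V) v) =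
      (((rangeChar hx i γ)⁻¹ : Fˣ) : F) * x i v := by
  obtain ⟨g, rfl⟩ := ρ.rangeRestrict_surjective γ
  -- The dual action inverts, so precomposition with ρ(g) is the action of g⁻¹.
  have h := LinearMap.congr_fun (hx g⁻¹ i) v
  rw [rangeChar_apply, ← map_inv]
  simpa [dualAct] using h

theorem eq_one_of_forall_rangeChar_eq_one {γ : ρ.range} (h : ∀ i, rangeChar hx i γ = 1) :
    γ = 1 := by
  refine Subtype.ext (Units.ext (LinearMap.ext fun v => sub_eq_zero.1 ?_))
  refine eq_zero_of_basis_dual_apply_eq_zero x fun i => ?_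
  rw [map_sub, basis_dual_apply_apply hx, h i]
  simp

theorem isPseudoreflection_iff (γ : ρ.range) :
    IsPseudoreflection (γ : LinearMap.GeneralLinearGroup F V) ↔
      ∃ i, rangeChar hx i γ ≠ 1 ∧ ∀ j, j ≠ i → rangeChar hx j γ = 1 := by
  constructor
  · rintro ⟨h1, ⟨W, hW, hfix⟩, -⟩
    -- A fixed vector is killed by each x_i with χ_i(γ) ≠ 1, so W lies in the hyperplane ker x_i and
    -- equals it. Two such indices would give proportional basis vectors.
    have hker : ∀ i, rangeChar hx i γ ≠ 1 → LinearMap.ker (x i) = W := by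
      intro i hi
      refine hW.le_iff.1 (fun v hv => ?_) |>.resolve_left (isCoatom_ker_basis_dual x i).1
      have h2 := basis_dual_apply_apply hx γ i v
      rw [hfix v hv] at h2
      by_contra hv0
      refine hi (inv_eq_one.1 (Units.ext ?_))
      exact mul_right_cancel₀ (b := x i v) hv0 (by rw [← h2, Units.val_one, one_mul])
    obtain ⟨i, hi⟩ : ∃ i, rangeChar hx i γ ≠ 1 := by
      by_contra! h
      exact h1 (congrArg Subtype.val (eq_one_of_forall_rangeChar_eq_one hx h))
    refine ⟨i, hi, fun j hj => ?_⟩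
    by_contra hj1
    have hle : ⨅ _ : Unit, LinearMap.ker (x i) ≤ LinearMap.ker (x j) := by
      rw [hker i hi, hker j hj1]
      simp
    have hmem := mem_span_of_iInf_ker_le_ker (L := fun _ : Unit => x i) hle
    rw [Set.range_const] at hmem
    have hli := x.linearIndependent.notMem_span_image (s := {i}) (x := j) (by simpa using hj)
    rw [Set.image_singleton] at hli
    exact hli hmem
  · rintro ⟨i, hi, hj⟩
    have hi' : (((rangeChar hx i γ)⁻¹ : Fˣ) : F) ≠ 1 := fun h =>
      hi (inv_eq_one.1 (Units.ext h))
    refine ⟨?_, ⟨LinearMap.ker (x i), isCoatom_ker_basis_dual x i, fun v hv => ?_⟩, ?_⟩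
    · intro h
      refine hi ?_
      rw [show γ = 1 from Subtype.ext h, map_one]
    · refine sub_eq_zero.1 (eq_zero_of_basis_dual_apply_eq_zero x fun j => ?_)
      rw [map_sub, basis_dual_apply_apply hx]
      by_cases hji : j = i
      · rw [hji, LinearMap.mem_ker.1 hv]
        simp
      · rw [hj j hji]
        simp
    · rintro ⟨k, hk⟩
      obtain ⟨v, hv⟩ := exists_basis_dual_apply_ne_zero x i
      -- On the coordinate x_i, γ - 1 acts as a non-zero scalar, so no power of it vanishes.
      have hpow : ∀ m : ℕ, x i
          (((((γ : LinearMap.GeneralLinearGroup F V) : V →ₗ[F] V) - LinearMap.id) ^ m :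
            V →ₗ[F] V) v) =
            ((((rangeChar hx i γ)⁻¹ : Fˣ) : F) - 1) ^ m * x i v := by
        intro m
        induction m with
        | zero => simp
        | succ m ih =>
          rw [pow_succ', Module.End.mul_apply, LinearMap.sub_apply, map_sub,
            basis_dual_apply_apply hx, LinearMap.id_apply, ih]
          ring
      have h0 := hpow k
      rw [hk, LinearMap.zero_apply, map_zero] at h0
      exact mul_ne_zero (pow_ne_zero k (sub_ne_zero.2 hi')) hv h0.symm

theorem reflectionSubgroup_le (Γ : Subgroup (LinearMap.GeneralLinearGroup F V)) :
    reflectionSubgroup Γ ≤ Γ := (Subgroup.closure_le Γ).2 fun _ h => h.1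

theorem reflectionSubgroup_le_map_ker_iff {Γ : Subgroup (LinearMap.GeneralLinearGroup F V)}
    (φ : Γ →* Fˣ) : reflectionSubgroup Γ ≤ φ.ker.map Γ.subtype ↔ φ ∈ homZero Γ := by
  rw [reflectionSubgroup, Subgroup.closure_le]
  constructor
  · intro h γ hγ
    obtain ⟨δ, hδ, h1⟩ := h ⟨γ.2, hγ⟩
    rwa [← Subtype.ext h1]
  · intro h γ hγ
    exact ⟨⟨γ, hγ.1⟩, h ⟨γ, hγ.1⟩ hγ.2, rfl⟩

theorem powProd_rangeChar_apply_of_forall_ne {γ : ρ.range} {i : Fin n}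
    (h : ∀ j, j ≠ i → rangeChar hx j γ = 1) (a : Fin n →₀ ℕ) :
    powProd (rangeChar hx) a γ = rangeChar hx i γ ^ a i := by
  rw [powProd, MonoidHom.finsetProd_apply, Finset.prod_eq_single i]
  · rfl
  · intro j _ hj
    rw [MonoidHom.pow_apply, h j hj, one_pow]
  · simp

end Pseudoreflections

/-! ### Characters trivial on pseudoreflections, invariants of G₁, class group -/

section Characters

variable {F : Type*} [Field F] {V : Type*} [AddCommGroup V] [Module F V] {n : ℕ}
  {G : Type*} {x : Module.Basis (Fin n) F (Module.Dual F V)}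

/-- Pulling characters back along the surjection G → ρ(G) is injective. -/
theorem relOrder_rangeChar [Group G] {ρ : G →* LinearMap.GeneralLinearGroup F V}
    {χ : Fin n → (G →* Fˣ)} (hx : IsEigenbasis ρ x χ) (i : Fin n) :
    relOrder (rangeChar hx) i = relOrder χ i := by
  have h : (fun j => MonoidHom.compHom' ρ.rangeRestrict (rangeChar hx j)) = χ := by
    funext j
    ext g
    exact congrArg Units.val (rangeChar_apply hx j g)
  have hinj : Function.Injective
      (MonoidHom.compHom' ρ.rangeRestrict : (ρ.range →* Fˣ) →* (G →* Fˣ)) := fun φ ψ hφψ =>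
    (MonoidHom.cancel_right ρ.rangeRestrict_surjective).1 hφψ
  rw [← relOrder_map (rangeChar hx) _ hinj, h]

theorem isLeast_varIndex [Group G] {ρ : G →* LinearMap.GeneralLinearGroup F V} [Finite ρ.range]
    {χ : Fin n → (G →* Fˣ)} (hx : IsEigenbasis ρ x χ) (i : Fin n) :
    IsLeast {k : ℕ | 0 < k ∧ χ i ^ k ∈ Subgroup.closure (χ '' {j | j ≠ i})} (varIndex hx i) := by
  refine ⟨⟨varIndex_pos hx i, ?_⟩, ?_⟩
  · rw [pow_mem_closure_iff_relOrder_dvd, varIndex_eq_relOrder, relOrder_rangeChar]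
  · rintro k ⟨hk, hmem⟩
    rw [pow_mem_closure_iff_relOrder_dvd] at hmem
    rw [varIndex_eq_relOrder, relOrder_rangeChar]
    exact Nat.le_of_dvd hk hmem

variable [IsAlgClosed F] [CommGroup G] [Finite G] (hchar : ¬ ringChar F ∣ Nat.card G)
  {ρ : G →* LinearMap.GeneralLinearGroup F V} {χ : Fin n → (G →* Fˣ)} (hx : IsEigenbasis ρ x χ)

instance : Finite ρ.range := Finite.of_surjective _ ρ.rangeRestrict_surjective

include hchar

/-- The joint kernel of the χ_i is ker ρ, on which every pulled-back character is trivial; duality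
is applied on `G`. -/
theorem exists_powProd_rangeChar_eq (φ : ρ.range →* Fˣ) :
    ∃ a, powProd (rangeChar hx) a = φ := by
  obtain ⟨a, ha⟩ := exists_powProd_eq_of_forall hchar χ (φ.comp ρ.rangeRestrict) fun g hg => by
    rw [MonoidHom.comp_apply, eq_one_of_forall_rangeChar_eq_one hx (γ := ρ.rangeRestrict g),
      map_one]
    intro i
    rw [rangeChar_apply, hg i]
  refine ⟨a, ?_⟩
  ext γ
  obtain ⟨g, rfl⟩ := ρ.rangeRestrict_surjective γ
  rw [← MonoidHom.comp_apply φ, ← ha, powProd, powProd, MonoidHom.finsetProd_apply,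
    MonoidHom.finsetProd_apply]
  simp [rangeChar_apply]

/-- On a pseudoreflection only one χ_i survives, so χ^a becomes χ_i^(a_i); by duality this is always
trivial iff e(x_i) ∣ a_i. -/
theorem powProd_rangeChar_mem_homZero_iff (a : Fin n →₀ ℕ) :
    powProd (rangeChar hx) a ∈ homZero ρ.range ↔ ∀ i, varIndex hx i ∣ a i := by
  simp only [varIndex_eq_relOrder, relOrder_rangeChar, relOrder_dvd_iff_forall hchar]
  constructor
  · intro h i g hg
    have hg' : ∀ j, j ≠ i → rangeChar hx j (ρ.rangeRestrict g) = 1 := fun j hj => by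
      rw [rangeChar_apply, hg j hj]
    by_cases hi : χ i g = 1
    · rw [hi, one_pow]
    · rw [← rangeChar_apply hx, ← powProd_rangeChar_apply_of_forall_ne hx hg']
      exact h _ ((isPseudoreflection_iff hx _).2 ⟨i, by rwa [rangeChar_apply], hg'⟩)
  · intro h γ hγ
    obtain ⟨i, -, hi⟩ := (isPseudoreflection_iff hx γ).1 hγ
    rw [powProd_rangeChar_apply_of_forall_ne hx hi]
    obtain ⟨g, rfl⟩ := ρ.rangeRestrict_surjective γ
    simp only [rangeChar_apply] at hi ⊢
    exact h i g hi

theorem closure_rangeChar_pow_eq_homZero :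
    Subgroup.closure (Set.range fun i => rangeChar hx i ^ varIndex hx i) = homZero ρ.range := by
  apply le_antisymm
  · rw [Subgroup.closure_le]
    rintro _ ⟨i, rfl⟩
    dsimp only
    rw [← powProd_single (rangeChar hx), SetLike.mem_coe, powProd_rangeChar_mem_homZero_iff hchar]
    intro j
    by_cases hj : j = i
    · rw [hj, Finsupp.single_eq_same]
    · rw [Finsupp.single_eq_of_ne hj]
      exact dvd_zero _
  · intro φ hφ
    obtain ⟨a, rfl⟩ := exists_powProd_rangeChar_eq hchar hx φ
    obtain ⟨b, rfl⟩ := exists_scale_eq ((powProd_rangeChar_mem_homZero_iff hchar hx a).1 hφ)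
    rw [← powProd_pow]
    exact prod_mem fun i _ => pow_mem (Subgroup.subset_closure (Set.mem_range_self i)) _

/-- A monomial x^a is G₁-invariant iff χ^a ∈ Hom⁰, so the invariants are spanned by the monomials
with e(x_i) ∣ a_i. -/
theorem adjoin_X_pow_eq_invariantRing :
    Algebra.adjoin F (Set.range fun i =>
      (MvPolynomial.X i : MvPolynomial (Fin n) F) ^ varIndex hx i) =
        invariantRing x (reflectionSubgroup ρ.range) := by
  have hmem : ∀ f : MvPolynomial (Fin n) F, f ∈ invariantRing x (reflectionSubgroup ρ.range) ↔
      ∀ a ∈ f.support, ∀ i, varIndex hx i ∣ a i := fun f => by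
    simp only [mem_invariantRing_iff hx (reflectionSubgroup_le _),
      reflectionSubgroup_le_map_ker_iff, powProd_rangeChar_mem_homZero_iff hchar]
  apply le_antisymm
  · refine Algebra.adjoin_le ?_
    rintro _ ⟨i, rfl⟩
    dsimp only
    rw [SetLike.mem_coe, hmem, MvPolynomial.X_pow_eq_monomial]
    intro a ha j
    rw [Finset.mem_singleton.1 (MvPolynomial.support_monomial_subset ha)]
    by_cases hj : j = i
    · rw [hj, Finsupp.single_eq_same]
    · rw [Finsupp.single_eq_of_ne hj]
      exact dvd_zero _
  · intro f hf
    rw [f.as_sum]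
    refine sum_mem fun a ha => ?_
    obtain ⟨b, hb⟩ := exists_scale_eq ((hmem f).1 hf a ha)
    rw [MvPolynomial.monomial_eq, ← MvPolynomial.algebraMap_eq,
      Finsupp.prod_fintype _ _ (by simp)]
    refine mul_mem (Subalgebra.algebraMap_mem _ _) ?_
    have h := powProd_pow (fun i => (MvPolynomial.X i : MvPolynomial (Fin n) F)) (varIndex hx) b
    rw [hb, powProd, powProd] at h
    rw [← h]
    exact prod_mem fun i _ => pow_mem (Algebra.subset_adjoin (Set.mem_range_self i)) _

theorem divWeight_mem_homZero (m : gcdMonomials hx) :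
    divWeight x ρ.range m ∈ homZero ρ.range := by
  obtain ⟨b, rfl⟩ := (powProd_varPow_bijective hx).2 m
  rw [coe_powProd_varPow, divWeight_monomialDiv, powProd_rangeChar_mem_homZero_iff hchar]
  intro i
  exact Dvd.intro _ rfl

theorem exists_classGroupOf_invariantMonomials_mulEquiv :
    ∃ Φ : ClassGroupOf (Submonoid.inclusion (invariantMonomials_le hx)) ≃* homZero ρ.range,
      ∀ m : gcdMonomials hx,
        (Φ (classOf (Submonoid.inclusion (invariantMonomials_le hx)) m) : ρ.range →* Fˣ) =
          divWeight x ρ.range m := by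
  let w : gcdMonomials hx →* homZero ρ.range :=
    ((divWeight x ρ.range).comp (gcdMonomials hx).subtype).codRestrict _
      (divWeight_mem_homZero hchar hx)
  have hw : ∀ m : gcdMonomials hx, (w m : ρ.range →* Fˣ) = divWeight x ρ.range m := fun _ => rfl
  have hsurj : Function.Surjective w := by
    rintro ⟨φ, hφ⟩
    obtain ⟨a, rfl⟩ := exists_powProd_rangeChar_eq hchar hx φ
    obtain ⟨b, rfl⟩ := exists_scale_eq ((powProd_rangeChar_mem_homZero_iff hchar hx a).1 hφ)
    exact ⟨powProd (varPow hx) b, Subtype.ext (by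
      rw [hw, coe_powProd_varPow, divWeight_monomialDiv])⟩
  have hker : ∀ m, w m = 1 ↔ m ∈ Set.range (Submonoid.inclusion (invariantMonomials_le hx)) := by
    intro m
    rw [← OneMemClass.coe_eq_one, hw, ← mem_invDiv_iff]
    constructor
    · exact fun h => ⟨⟨m, m.2.1, h⟩, rfl⟩
    · rintro ⟨h, rfl⟩
      exact h.2.2
  obtain ⟨Φ, hΦ⟩ := exists_classGroupOf_mulEquiv _ w hsurj hker
  exact ⟨Φ, fun m => by rw [hΦ, hw]⟩

end Characters

end

end InvTheory

theorem mainTheorem4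
    {F : Type*} [Field F] [IsAlgClosed F]
    {G : Type*} [CommGroup G] [Finite G] (hchar : ¬ ringChar F ∣ Nat.card G)
    {V : Type*} [AddCommGroup V] [Module F V] [FiniteDimensional F V]
    (ρ : G →* LinearMap.GeneralLinearGroup F V)
    {n : ℕ} (x : Module.Basis (Fin n) F (Module.Dual F V))
    (χ : Fin n → (G →* Fˣ)) (hx : IsEigenbasis ρ x χ) :
    ∃ D₀ M₀ : Submonoid (RelDiv x ρ.range),
      (D₀ : Set (RelDiv x ρ.range)) = gcdDiv x ρ.range ∧
      M₀ = monDiv x ρ.range ⊓ D₀ ∧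
      -- Part 1
      (IsDivisorClosed M₀ D₀ ∧
        IsFreeAbelian M₀ ∧
        atomsOf M₀ = (monDiv x ρ.range : Set (RelDiv x ρ.range)) ∩ atomsOf D₀ ∧
        atomsOf M₀ = Set.range fun i => varDiv hx i ^ varIndex hx i) ∧
      -- Part 2
      (∀ i, IsLeast {k : ℕ | 0 < k ∧ χ i ^ k ∈ Subgroup.closure (χ '' {j | j ≠ i})}
        (varIndex hx i)) ∧
      -- Part 3
      (Subgroup.closure (Set.range fun i => rangeChar hx i ^ varIndex hx i) =
          homZero ρ.range ∧
        Algebra.adjoin F (Set.range fun i =>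
            (MvPolynomial.X i : MvPolynomial (Fin n) F) ^ varIndex hx i) =
          invariantRing x (reflectionSubgroup ρ.range)) ∧
      -- Part 4
      (∃ hle : monDiv x ρ.range ⊓ invDiv x ρ.range ≤ M₀,
        IsDivisorTheory (Submonoid.inclusion hle) ∧
        ∃ Φ : ClassGroupOf (Submonoid.inclusion hle) ≃* homZero ρ.range,
          (∀ m : M₀, (Φ (classOf (Submonoid.inclusion hle) m) : ρ.range →* Fˣ) =
            divWeight x ρ.range m) ∧
          (fun c => (Φ c : ρ.range →* Fˣ)) '' primeClasses (Submonoid.inclusion hle) =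
            Set.range fun i => rangeChar hx i ^ varIndex hx i) := by
  obtain ⟨Φ, hΦ⟩ := exists_classGroupOf_invariantMonomials_mulEquiv hchar hx
  refine ⟨gcdSubmonoid hx, gcdMonomials hx, rfl, rfl,
    ⟨isDivisorClosed_gcdMonomials hx, ⟨_, isFreeBasis_range_of_bijective _
      (powProd_varPow_bijective hx)⟩, ?_, atomsOf_gcdMonomials hx⟩,
    isLeast_varIndex hx,
    ⟨closure_rangeChar_pow_eq_homZero hchar hx, adjoin_X_pow_eq_invariantRing hchar hx⟩,
    invariantMonomials_le hx, isDivisorTheory_invariantMonomials hx, Φ, hΦ, ?_⟩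
  -- Atoms of D₀ lie in D₀, so intersecting them with M or with M₀ is the same.
  · rw [(isDivisorClosed_gcdMonomials hx).atomsOf_eq]
    refine Set.ext fun d => ⟨fun h => ⟨h.1.1, h.2⟩, fun h => ⟨⟨h.1, atomsOf_subset _ h.2⟩, h.2⟩⟩
  -- The primes of a free abelian monoid are its basis elements, here the x_i^(e(x_i)), whose
  -- weights are the listed characters.
  · have h : {p : gcdMonomials hx | IsPrimeElement p} = Set.range (varPow hx) :=
      Set.ext fun p => isPrimeElement_iff_mem_range (powProd_varPow_bijective hx) p
    rw [primeClasses, h, ← Set.range_comp, ← Set.range_comp]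
    refine congrArg Set.range (funext fun i => ?_)
    refine (hΦ (varPow hx i)).trans ?_
    rw [coe_varPow, ← monomialDiv_single, divWeight_monomialDiv, powProd_single]
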